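/- Let $2\le p<\infty$, $c_0>0$ and $K\ge 0$. Then there is a constant $C=C(p,c_0,K)>0$ such that the following holds. Let $N$ be a (finite-dimensional) smooth Riemannian manifold without boundary, with Levi-Civita connection $\nabla$ and Riemannian curvature tensor $R$ satisfying $\|R\|_\infty\le K$, where $\|R\|_\infty$ is the supremum over $N$ of the pointwise operator norm of $R$. Let $a<b$ be real numbers, let $S^1=\mathbb{R}/\mathbb{Z}$, and let $u:(a,b]\times S^1\to N$ be a smooth map (smooth up to the boundary circle $s=b$) with $$\|\partial_s u\|_\infty+\|\partial_t u\|_\infty\le c_0 .$$ Then, for all smooth compactly supported vector fields $\xi$ and $X$ along $u$, $$\left(\int_a^b\int_0^1\bigl(|\nabla_t\xi|\,|\nabla_tX|\bigr)^p\,dt\,ds\right)^{1/p}\le C\,\|\xi\|_{\mathcal{W}^{1,p}}\bigl(\|\nabla_tX\|_p+\|\nabla_t\nabla_tX\|_p\bigr).$$ Here $\nabla_s$ and $\nabla_t$ are the covariant derivatives along $u$ in the directions $s$ and $t$, $\|\cdot\|_p$ is the $L^p$ norm on $(a,b]\times S^1$, compact support means compact support in $(a,b]\times S^1$ (so a field need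 not vanish at $s=b$), and $$\|\xi\|_{\mathcal{W}^{1,p}}=\left(\int_a^b\int_0^1|\xi|^p+|\nabla_s\xi|^p+|\nabla_t\xi|^p+|\nabla_t\nabla_t\xi|^p\,dt\,ds\right)^{1/p}.$$ -/

import Mathlib

open Set MeasureTheory Bundle
open scoped Manifold ContDiff ENNReal NNReal

noncomputable section

namespace RiemannianCylinder

/-! ### Levi-Civita connection and curvature in charts

`N` is a smooth manifold without boundary, modelled on a finite-dimensional real vector space `E`,
with a smooth Riemannian metric (`RiemannianBundle` on the tangent bundle). -/

section Geometry

variable {E : Type*} [NormedAddCommGroup E] [NormedSpace ℝ E]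
  {N : Type*} [TopologicalSpace N] [ChartedSpace E N]

/-- The differential at `y` of the inverse of the preferred chart `φ` around `x`: it sends a
coordinate vector to the tangent vector at `φ⁻¹ y` that it represents. -/
def fromChart (x : N) (y : E) :
    E →L[ℝ] TangentSpace 𝓘(ℝ, E) ((extChartAt 𝓘(ℝ, E) x).symm y) :=
  mfderiv 𝓘(ℝ, E) 𝓘(ℝ, E) (extChartAt 𝓘(ℝ, E) x).symm y

/-- The differential at `q` of the preferred chart `φ` around `x`: it sends a tangent vector at `q`
to its coordinate vector. -/
def toChart (x q : N) : TangentSpace 𝓘(ℝ, E) q →L[ℝ] E :=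
  mfderiv 𝓘(ℝ, E) 𝓘(ℝ, E) (extChartAt 𝓘(ℝ, E) x) q

variable [RiemannianBundle (fun q : N ↦ TangentSpace 𝓘(ℝ, E) q)]

/-- The metric in the preferred chart around `x`, as a map `y ↦ (g_{ij}(y))` from coordinates to
bilinear forms. -/
def chartMetric (x : N) (y : E) : E →L[ℝ] E →L[ℝ] ℝ :=
  (innerSL ℝ (E := TangentSpace 𝓘(ℝ, E) ((extChartAt 𝓘(ℝ, E) x).symm y))).bilinearComp
    (fromChart x y) (fromChart x y)

/-- The Christoffel symbols of the Levi-Civita connection in the preferred chart around `x`: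
`Γ(v, w)` is the vector with
`g(Γ(v, w), z) = ½ ((∂_v g)(w, z) + (∂_w g)(v, z) - (∂_z g)(v, w))` for all `z`. -/
def christoffel (x : N) (y v w : E) : E :=
  (chartMetric x y).inverse
    ((1 / 2 : ℝ) • (fderiv ℝ (chartMetric x) y v w + fderiv ℝ (chartMetric x) y w v
      - ((fderiv ℝ (chartMetric x) y).flip v).flip w))

/-- The Riemannian curvature tensor at `x` applied to coordinate vectors in the preferred chart
around `x`:
`R(v, w) z = (∂_v Γ)(w, z) - (∂_w Γ)(v, z) + Γ(v, Γ(w, z)) - Γ(w, Γ(v, z))`. -/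
def chartCurvature (x : N) (v w z : E) : E :=
  let y : E := extChartAt 𝓘(ℝ, E) x x
  fderiv ℝ (fun y' ↦ christoffel x y' w z) y v - fderiv ℝ (fun y' ↦ christoffel x y' v z) y w
    + christoffel x y v (christoffel x y w z) - christoffel x y w (christoffel x y v z)

/-- The Riemannian curvature tensor `R(X, Y) Z = ∇_X ∇_Y Z - ∇_Y ∇_X Z - ∇_{[X, Y]} Z` at `x`. -/
def curvature (x : N) (X Y Z : TangentSpace 𝓘(ℝ, E) x) : TangentSpace 𝓘(ℝ, E) x :=
  fromChart x (extChartAt 𝓘(ℝ, E) x x)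
    (chartCurvature x (toChart x x X) (toChart x x Y) (toChart x x Z))

variable (E N) in
/-- The supremum norm `‖R‖_∞` of the curvature tensor, built on the pointwise operator norm. -/
def curvatureSupNorm : ℝ≥0∞ :=
  ⨆ (x : N) (X : TangentSpace 𝓘(ℝ, E) x) (Y : TangentSpace 𝓘(ℝ, E) x)
    (Z : TangentSpace 𝓘(ℝ, E) x) (_ : ‖X‖ ≤ 1) (_ : ‖Y‖ ≤ 1) (_ : ‖Z‖ ≤ 1),
    ‖curvature x X Y Z‖ₑ

/-! ### Calculus along a map defined on a subset of the plane -/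

/-- The derivative in the direction `e` of a map `u` defined on `S`. -/
def mapDeriv (S : Set (ℝ × ℝ)) (u : ℝ × ℝ → N) (e : ℝ × ℝ) (z : ℝ × ℝ) :
    TangentSpace 𝓘(ℝ, E) (u z) :=
  mfderivWithin 𝓘(ℝ, ℝ × ℝ) 𝓘(ℝ, E) u S z e

/-- The covariant derivative in the direction `e` of a vector field `ξ` along a map `u` defined on
`S`, for the Levi-Civita connection: in the preferred chart around `u z`,
`∇_e ξ = ∂_e ξ + Γ(∂_e u, ξ)`. -/
def covDeriv (S : Set (ℝ × ℝ)) (u : ℝ × ℝ → N) (e : ℝ × ℝ)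
    (ξ : ∀ z, TangentSpace 𝓘(ℝ, E) (u z)) (z : ℝ × ℝ) : TangentSpace 𝓘(ℝ, E) (u z) :=
  fromChart (u z) (extChartAt 𝓘(ℝ, E) (u z) (u z))
    (fderivWithin ℝ (fun z' ↦ toChart (u z) (u z') (ξ z')) S z e
      + christoffel (u z) (extChartAt 𝓘(ℝ, E) (u z) (u z))
          (toChart (u z) (u z) (mapDeriv S u e z)) (toChart (u z) (u z) (ξ z)))

end Geometry

/-! ### The half-open cylinder `(a, b] × S¹`, with `S¹ = ℝ / ℤ`

Maps on the cylinder are maps on `(a, b] × ℝ` which are `1`-periodic in the second variable. -/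

/-- The strip `(a, b] × ℝ` that covers the cylinder. -/
def strip (a b : ℝ) : Set (ℝ × ℝ) := Ioc a b ×ˢ univ

section Cylinder

variable {E : Type*} [NormedAddCommGroup E] [NormedSpace ℝ E]
  {N : Type*} [TopologicalSpace N] [ChartedSpace E N]

/-- `u` is a smooth map `(a, b] × S¹ → N` (smooth up to the boundary circle `s = b`). -/
structure IsSmoothMap (E : Type*) [NormedAddCommGroup E] [NormedSpace ℝ E]
    {N : Type*} [TopologicalSpace N] [ChartedSpace E N] (a b : ℝ) (u : ℝ × ℝ → N) : Prop where
  smooth : ContMDiffOn 𝓘(ℝ, ℝ × ℝ) 𝓘(ℝ, E) ∞ u (strip a b)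
  periodic : ∀ s ∈ Ioc a b, ∀ t : ℝ, u (s, t + 1) = u (s, t)

/-- `ξ` is a smooth compactly supported vector field along `u : (a, b] × S¹ → N`. Since `S¹` is
compact, its support is compact when it projects into a compact subset of `(a, b]`. -/
structure IsSmoothCompactField [IsManifold 𝓘(ℝ, E) ∞ N] (a b : ℝ) (u : ℝ × ℝ → N)
    (ξ : ∀ z, TangentSpace 𝓘(ℝ, E) (u z)) : Prop where
  smooth : ContMDiffOn 𝓘(ℝ, ℝ × ℝ) 𝓘(ℝ, E).tangent ∞
    (fun z ↦ (⟨u z, ξ z⟩ : TangentBundle 𝓘(ℝ, E) N)) (strip a b)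
  periodic : ∀ s ∈ Ioc a b, ∀ t : ℝ,
    (⟨u (s, t + 1), ξ (s, t + 1)⟩ : TangentBundle 𝓘(ℝ, E) N) = ⟨u (s, t), ξ (s, t)⟩
  compactSupport : ∃ K : Set ℝ, IsCompact K ∧ K ⊆ Ioc a b ∧
    ∀ s ∈ Ioc a b, s ∉ K → ∀ t : ℝ, ξ (s, t) = 0

variable [RiemannianBundle (fun q : N ↦ TangentSpace 𝓘(ℝ, E) q)]

/-- `∇_s ξ` on `(a, b] × S¹`. -/
def covDerivS (a b : ℝ) (u : ℝ × ℝ → N) (ξ : ∀ z, TangentSpace 𝓘(ℝ, E) (u z)) :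
    ∀ z, TangentSpace 𝓘(ℝ, E) (u z) :=
  covDeriv (strip a b) u (1, 0) ξ

/-- `∇_t ξ` on `(a, b] × S¹`. -/
def covDerivT (a b : ℝ) (u : ℝ × ℝ → N) (ξ : ∀ z, TangentSpace 𝓘(ℝ, E) (u z)) :
    ∀ z, TangentSpace 𝓘(ℝ, E) (u z) :=
  covDeriv (strip a b) u (0, 1) ξ

/-- The supremum norm of a vector field along `u : (a, b] × S¹ → N`. -/
def supNorm (a b : ℝ) (u : ℝ × ℝ → N) (ξ : ∀ z, TangentSpace 𝓘(ℝ, E) (u z)) : ℝ≥0∞ :=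
  ⨆ z ∈ strip a b, ‖ξ z‖ₑ

/-- The `L^p` norm of a real function on `(a, b] × S¹`, computed on the fundamental domain
`(a, b] × (0, 1]`. -/
def lpNorm (a b p : ℝ) (f : ℝ × ℝ → ℝ) : ℝ≥0∞ :=
  eLpNorm f (ENNReal.ofReal p) (volume.restrict (Ioc a b ×ˢ Ioc (0 : ℝ) 1))

/-- The `L^p` norm of a vector field along `u : (a, b] × S¹ → N`. -/
def fieldLpNorm (a b p : ℝ) (u : ℝ × ℝ → N) (ξ : ∀ z, TangentSpace 𝓘(ℝ, E) (u z)) : ℝ≥0∞ :=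
  lpNorm a b p (fun z ↦ ‖ξ z‖)

/-- The parabolic Sobolev norm
`‖ξ‖_{𝒲^{1,p}} = (∫ |ξ|^p + |∇_s ξ|^p + |∇_t ξ|^p + |∇_t ∇_t ξ|^p)^{1/p}`. -/
def parabolicNorm (a b p : ℝ) (u : ℝ × ℝ → N) (ξ : ∀ z, TangentSpace 𝓘(ℝ, E) (u z)) : ℝ≥0∞ :=
  (fieldLpNorm a b p u ξ ^ p + fieldLpNorm a b p u (covDerivS a b u ξ) ^ p
    + fieldLpNorm a b p u (covDerivT a b u ξ) ^ p
    + fieldLpNorm a b p u (covDerivT a b u (covDerivT a b u ξ)) ^ p) ^ (1 / p)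

end Cylinder

end RiemannianCylinder

end

/-! The exponents are matched by an anisotropic argument: `∇_t ξ` is bounded in `L^∞` in `s` with
values in `L^p` of the circle, `∇_t X` is bounded in `L^p` in `s` with values in `L^∞` of the
circle, and Fubini multiplies the two bounds.

The bound for `∇_t X` is the one-dimensional Sobolev inequality on each circle, applied to `|∇_t
X|^p` (`rpow_le_lintegral_circle`). The bound for `∇_t ξ` is a parabolic trace estimate
(`trace_estimate`). Since the connection is metric and torsion-free, `½ ∂_s |∇_t ξ|² = ∂_t ⟨∇_t ξ,
∇_s ξ⟩ - ⟨∇_t ∇_t ξ, ∇_s ξ⟩ + ⟨∇_t ξ, R(∂_s u, ∂_t u) ξ⟩`. Multiply by `p |∇_t ξ|^(p-2)` and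
integrate over `[a', s] × S¹`, where `ξ` vanishes near `s = a'`. The `t`-derivative is integrated by
parts, without boundary terms by periodicity, and falls on `|∇_t ξ|^(p-2)`. No mixed derivative `∇_t
∇_s ξ` survives, and Young's inequality bounds what is left by `‖ξ‖_{𝒲^{1,p}}^p`. As `|∇_t ξ|` need
not be differentiable at its zeros, `|∇_t ξ|²` is replaced by `|∇_t ξ|² + ε`.

The geometric input is metric compatibility (`fderiv_inner_field`) and the Ricci identity
(`covDeriv_comm`). `covDeriv` is defined in a chart that moves with the point, so both rest on its
independence of the chart (`toChart_covDeriv`), that is, on the transformation law of the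
Christoffel symbols. All calculus takes place on the open cylinder `s < b`; the circle `s = b` is a
null set. -/

set_option maxSynthPendingDepth 3

namespace RiemannianCylinder

noncomputable section

open scoped Topology
open Filter

/-! ### The Levi-Civita connection of a metric on an open subset of a vector space -/

section LocalConnection

variable {E : Type*} [NormedAddCommGroup E] [NormedSpace ℝ E]
  {P : Type*} [NormedAddCommGroup P] [NormedSpace ℝ P]

/-- The Christoffel symbols of the first kind determined by the derivative of a metric. -/
def christoffelForm (D : E →L[ℝ] E →L[ℝ] E →L[ℝ] ℝ) : E →L[ℝ] E →L[ℝ] E →L[ℝ] ℝ :=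
  (1 / 2 : ℝ) • (D + D.flip
    - ((ContinuousLinearMap.flipₗᵢ ℝ E E ℝ).toLinearIsometry.toContinuousLinearMap).comp D.flip)

lemma christoffelForm_apply (D : E →L[ℝ] E →L[ℝ] E →L[ℝ] ℝ) (v w : E) :
    christoffelForm D v w = (1 / 2 : ℝ) • (D v w + D w v - (D.flip v).flip w) := by
  ext z
  simp [christoffelForm]

/-- The Christoffel symbols of the second kind of the metric `g`, as a bilinear map. -/
def christoffelMap (g : E → E →L[ℝ] E →L[ℝ] ℝ) (y : E) : E →L[ℝ] E →L[ℝ] E :=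
  (ContinuousLinearMap.compL ℝ E (E →L[ℝ] ℝ) E (g y).inverse).comp
    (christoffelForm (fderiv ℝ g y))

/-- For `g = chartMetric x` the right-hand side is the definition of `christoffel`; this is the
bridge from the statement to the bundled bilinear map. -/
lemma christoffelMap_apply (g : E → E →L[ℝ] E →L[ℝ] ℝ) (y v w : E) :
    christoffelMap g y v w = (g y).inverse
      ((1 / 2 : ℝ) • (fderiv ℝ g y v w + fderiv ℝ g y w v - ((fderiv ℝ g y).flip v).flip w)) := by
  rw [← christoffelForm_apply]
  rfl

/-- The covariant derivative in the direction `e` of a vector field `v` along `c`, for the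
Levi-Civita connection of `g`. -/
def localCovDeriv (g : E → E →L[ℝ] E →L[ℝ] ℝ) (c v : P → E) (e : P) (z : P) : E :=
  fderiv ℝ v z e + christoffelMap g (c z) (fderiv ℝ c z e) (v z)

variable {g : E → E →L[ℝ] E →L[ℝ] ℝ} {y : E}

lemma metric_christoffelMap (hinv : (g y).IsInvertible) (v w z : E) :
    g y (christoffelMap g y v w) z =
      1 / 2 * (fderiv ℝ g y v w z + fderiv ℝ g y w v z - fderiv ℝ g y z v w) := by
  rw [christoffelMap_apply, hinv.self_apply_inverse]
  simp

lemma fderiv_metric_apply (hg : DifferentiableAt ℝ g y) (z v w : E) :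
    fderiv ℝ (fun y' ↦ g y' v w) y z = fderiv ℝ g y z v w := by
  have h : HasFDerivAt (fun y' ↦ g y' v w) _ y :=
    ((hg.hasFDerivAt.clm_apply (hasFDerivAt_const v y)).clm_apply (hasFDerivAt_const w y))
  rw [h.fderiv]
  simp

lemma fderiv_metric_symm (hg : DifferentiableAt ℝ g y)
    (hsymm : ∀ᶠ y' in 𝓝 y, ∀ v w, g y' v w = g y' w v) (z v w : E) :
    fderiv ℝ g y z v w = fderiv ℝ g y z w v := by
  rw [← fderiv_metric_apply hg, ← fderiv_metric_apply hg]
  congr 1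
  exact Filter.EventuallyEq.fderiv_eq (hsymm.mono fun y' h ↦ h v w)

/-- Metric compatibility: in the sum of the two Koszul expressions four of the six terms cancel in
pairs by symmetry of `g`, and the other two coincide. -/
lemma fderiv_metric_eq (hg : DifferentiableAt ℝ g y)
    (hsymm : ∀ᶠ y' in 𝓝 y, ∀ v w, g y' v w = g y' w v) (hinv : (g y).IsInvertible) (v w z : E) :
    fderiv ℝ g y v w z = g y (christoffelMap g y v w) z + g y w (christoffelMap g y v z) := by
  rw [hsymm.self_of_nhds w, metric_christoffelMap hinv, metric_christoffelMap hinv,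
    fderiv_metric_symm hg hsymm v z w, fderiv_metric_symm hg hsymm w v z,
    fderiv_metric_symm hg hsymm z v w]
  ring

lemma fderiv_metric_pullback {g' : E → E →L[ℝ] E →L[ℝ] ℝ} {φ : E → E}
    (hg : DifferentiableAt ℝ g y) (hg' : DifferentiableAt ℝ g' (φ y)) (hφ : ContDiffAt ℝ 2 φ y)
    (h : ∀ᶠ y' in 𝓝 y, ∀ v w, g y' v w = g' (φ y') (fderiv ℝ φ y' v) (fderiv ℝ φ y' w))
    (z v w : E) :
    fderiv ℝ g y z v w =
      fderiv ℝ g' (φ y) (fderiv ℝ φ y z) (fderiv ℝ φ y v) (fderiv ℝ φ y w)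
      + g' (φ y) (fderiv ℝ (fderiv ℝ φ) y z v) (fderiv ℝ φ y w)
      + g' (φ y) (fderiv ℝ φ y v) (fderiv ℝ (fderiv ℝ φ) y z w) := by
  have hφ1 : HasFDerivAt φ (fderiv ℝ φ y) y := (hφ.differentiableAt (by simp)).hasFDerivAt
  have hφ2 : HasFDerivAt (fderiv ℝ φ) (fderiv ℝ (fderiv ℝ φ) y) y :=
    ((hφ.fderiv_right (m := 1) (by norm_num [one_add_one_eq_two])).differentiableAt
      (by simp)).hasFDerivAt
  have h1 := (hg'.hasFDerivAt.comp y hφ1)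
  have h2 := (h1.clm_apply (hφ2.clm_apply (hasFDerivAt_const v y))).clm_apply
    (hφ2.clm_apply (hasFDerivAt_const w y))
  have h3 := h2.congr_of_eventuallyEq (f₁ := fun y' ↦ g y' v w) (h.mono fun y' h ↦ h v w)
  rw [← fderiv_metric_apply hg, h3.fderiv]
  simp
  ring

/-- The transformation law of Christoffel symbols. Paired with `dφ z`, which is an arbitrary vector
by surjectivity, both sides become Koszul expressions; symmetry of `D²φ` and of `g'` leaves only the
term with `D²φ(v, w)`. -/
lemma fderiv_christoffelMap_pullback {g' : E → E →L[ℝ] E →L[ℝ] ℝ} {φ : E → E}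
    (hg : DifferentiableAt ℝ g y) (hg' : DifferentiableAt ℝ g' (φ y)) (hφ : ContDiffAt ℝ 2 φ y)
    (h : ∀ᶠ y' in 𝓝 y, ∀ v w, g y' v w = g' (φ y') (fderiv ℝ φ y' v) (fderiv ℝ φ y' w))
    (hsymm' : ∀ v w, g' (φ y) v w = g' (φ y) w v)
    (hinv : (g y).IsInvertible) (hinv' : (g' (φ y)).IsInvertible)
    (hsurj : Function.Surjective (fderiv ℝ φ y)) (v w : E) :
    fderiv ℝ φ y (christoffelMap g y v w) =
      christoffelMap g' (φ y) (fderiv ℝ φ y v) (fderiv ℝ φ y w)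
        + fderiv ℝ (fderiv ℝ φ) y v w := by
  apply hinv'.injective
  ext z'
  obtain ⟨z, rfl⟩ := hsurj z'
  have hD := fderiv_metric_pullback hg hg' hφ h
  have hsym2 : ∀ a b, fderiv ℝ (fderiv ℝ φ) y a b = fderiv ℝ (fderiv ℝ φ) y b a := by
    have := hφ.isSymmSndFDerivAt (by simp)
    exact fun a b ↦ this.eq a b
  rw [← h.self_of_nhds, metric_christoffelMap hinv, map_add, add_apply,
    metric_christoffelMap hinv', hD, hD, hD, hsym2 w v, hsym2 z v, hsym2 z w,
    hsymm' (fderiv ℝ φ y w) (fderiv ℝ (fderiv ℝ φ) y v z)]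
  ring

lemma contDiffAt_christoffelMap [CompleteSpace E] (hg : ContDiffAt ℝ ∞ g y)
    (hinv : (g y).IsInvertible) : ContDiffAt ℝ ∞ (christoffelMap g) y := by
  obtain ⟨e, he⟩ := hinv
  have h1 : ContDiffAt ℝ ∞ (fun y ↦ (g y).inverse) y := by
    have := contDiffAt_map_inverse (𝕜 := ℝ) (n := ∞) e
    rw [he] at this
    exact this.comp y hg
  have h2 : ContDiffAt ℝ ∞ (fderiv ℝ g) y := hg.fderiv_right (by simp)
  have h3 : ContDiffAt ℝ ∞ (fun y ↦ (fderiv ℝ g y).flip) y :=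
    ((ContinuousLinearMap.flipₗᵢ ℝ E E (E →L[ℝ] ℝ)).toLinearIsometry.toContinuousLinearMap
      ).contDiff.contDiffAt.comp y h2
  have h4 : ContDiffAt ℝ ∞ (fun y ↦ christoffelForm (fderiv ℝ g y)) y :=
    ((h2.add h3).sub (contDiffAt_const.clm_comp h3)).const_smul (1 / 2 : ℝ)
  exact ((ContinuousLinearMap.compL ℝ E (E →L[ℝ] ℝ) E).contDiff.contDiffAt.comp y h1).clm_comp h4

variable {c v w : P → E} {z : P}

lemma contDiffAt_localCovDeriv [CompleteSpace E] (hg : ContDiffAt ℝ ∞ g (c z))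
    (hinv : (g (c z)).IsInvertible) (hc : ContDiffAt ℝ ∞ c z) (hv : ContDiffAt ℝ ∞ v z) (e : P) :
    ContDiffAt ℝ ∞ (localCovDeriv g c v e) z := by
  have h1 : ContDiffAt ℝ ∞ (fun z ↦ fderiv ℝ v z e) z :=
    (hv.fderiv_right (by simp)).clm_apply contDiffAt_const
  have h2 : ContDiffAt ℝ ∞ (fun z ↦ fderiv ℝ c z e) z :=
    (hc.fderiv_right (by simp)).clm_apply contDiffAt_const
  exact h1.add ((((contDiffAt_christoffelMap hg hinv).comp z hc).clm_apply h2).clm_apply hv)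

lemma fderiv_metric_localCovDeriv (hg : DifferentiableAt ℝ g (c z))
    (hsymm : ∀ᶠ y' in 𝓝 (c z), ∀ v w, g y' v w = g y' w v) (hinv : (g (c z)).IsInvertible)
    (hc : DifferentiableAt ℝ c z) (hv : DifferentiableAt ℝ v z) (hw : DifferentiableAt ℝ w z)
    (e : P) :
    fderiv ℝ (fun z ↦ g (c z) (v z) (w z)) z e =
      g (c z) (localCovDeriv g c v e z) (w z) + g (c z) (v z) (localCovDeriv g c w e z) := by
  have h : HasFDerivAt (fun z ↦ g (c z) (v z) (w z)) _ z :=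
    (((hg.hasFDerivAt.comp z hc.hasFDerivAt).clm_apply hv.hasFDerivAt).clm_apply hw.hasFDerivAt)
  rw [h.fderiv]
  have := fderiv_metric_eq hg hsymm hinv (fderiv ℝ c z e) (v z) (w z)
  simp [localCovDeriv, this]
  ring

/-- Differentiating `dφ(c) v` produces `D²φ(∂_e c, v)`, exactly the inhomogeneous term in the
transformation law of the Christoffel symbols; hence the covariant derivative is a tensorial object.
-/
lemma fderiv_localCovDeriv {g' : E → E →L[ℝ] E →L[ℝ] ℝ} {φ : E → E} {c' v' : P → E}
    (hg : DifferentiableAt ℝ g (c z)) (hg' : DifferentiableAt ℝ g' (φ (c z)))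
    (hφ : ContDiffAt ℝ 2 φ (c z))
    (h : ∀ᶠ y' in 𝓝 (c z), ∀ v w, g y' v w = g' (φ y') (fderiv ℝ φ y' v) (fderiv ℝ φ y' w))
    (hsymm' : ∀ v w, g' (φ (c z)) v w = g' (φ (c z)) w v)
    (hinv : (g (c z)).IsInvertible) (hinv' : (g' (φ (c z))).IsInvertible)
    (hsurj : Function.Surjective (fderiv ℝ φ (c z)))
    (hc : DifferentiableAt ℝ c z) (hv : DifferentiableAt ℝ v z)
    (hc' : c' =ᶠ[𝓝 z] fun z ↦ φ (c z)) (hv' : v' =ᶠ[𝓝 z] fun z ↦ fderiv ℝ φ (c z) (v z)) (e : P) :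
    localCovDeriv g' c' v' e z = fderiv ℝ φ (c z) (localCovDeriv g c v e z) := by
  have hφ1 : HasFDerivAt φ (fderiv ℝ φ (c z)) (c z) :=
    (hφ.differentiableAt (by simp)).hasFDerivAt
  have hφ2 : HasFDerivAt (fderiv ℝ φ) (fderiv ℝ (fderiv ℝ φ) (c z)) (c z) :=
    ((hφ.fderiv_right (m := 1) (by norm_num [one_add_one_eq_two])).differentiableAt
      (by simp)).hasFDerivAt
  have h1 := ((hφ1.comp z hc.hasFDerivAt).congr_of_eventuallyEq hc').fderiv
  have h2 := (((hφ2.comp z hc.hasFDerivAt).clm_apply hv.hasFDerivAt).congr_of_eventuallyEq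
    hv').fderiv
  have h3 := fderiv_christoffelMap_pullback hg hg' hφ h hsymm' hinv hinv' hsurj
    (fderiv ℝ c z e) (v z)
  rw [localCovDeriv, localCovDeriv, map_add, h3, h1, h2, hc'.self_of_nhds, hv'.self_of_nhds]
  simp
  abel

/-- The curvature tensor of the metric `g`. -/
def localCurvature (g : E → E →L[ℝ] E →L[ℝ] ℝ) (y v w z : E) : E :=
  fderiv ℝ (christoffelMap g) y v w z - fderiv ℝ (christoffelMap g) y w v z
    + christoffelMap g y v (christoffelMap g y w z)
    - christoffelMap g y w (christoffelMap g y v z)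

lemma localCovDeriv_localCovDeriv (hΓ : DifferentiableAt ℝ (christoffelMap g) (c z))
    (hc : ContDiffAt ℝ 2 c z) (hv : ContDiffAt ℝ 2 v z) (e e' : P) :
    localCovDeriv g c (localCovDeriv g c v e') e z =
      fderiv ℝ (fderiv ℝ v) z e e'
      + (fderiv ℝ (christoffelMap g) (c z) (fderiv ℝ c z e) (fderiv ℝ c z e') (v z)
        + christoffelMap g (c z) (fderiv ℝ (fderiv ℝ c) z e e') (v z)
        + christoffelMap g (c z) (fderiv ℝ c z e') (fderiv ℝ v z e))
      + christoffelMap g (c z) (fderiv ℝ c z e)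
          (fderiv ℝ v z e' + christoffelMap g (c z) (fderiv ℝ c z e') (v z)) := by
  have hd : ∀ {f : P → E}, ContDiffAt ℝ 2 f z →
      HasFDerivAt (fderiv ℝ f) (fderiv ℝ (fderiv ℝ f) z) z := fun hf ↦
    ((hf.fderiv_right (m := 1) (by norm_num [one_add_one_eq_two])).differentiableAt
      (by simp)).hasFDerivAt
  have hc1 := (hc.differentiableAt (by simp)).hasFDerivAt
  have hv1 := (hv.differentiableAt (by simp)).hasFDerivAt
  have h : HasFDerivAt (localCovDeriv g c v e') _ z :=
    ((hd hv).clm_apply (hasFDerivAt_const e' z)).add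
    (((hΓ.hasFDerivAt.comp z hc1).clm_apply
      ((hd hc).clm_apply (hasFDerivAt_const e' z))).clm_apply hv1)
  rw [localCovDeriv, h.fderiv]
  simp [localCovDeriv]
  abel

/-- By symmetry of second derivatives, everything in the expanded second covariant derivative is
symmetric in `e` and `e'` except the terms that make up the curvature. -/
lemma localCovDeriv_comm (hΓ : DifferentiableAt ℝ (christoffelMap g) (c z))
    (hc : ContDiffAt ℝ 2 c z) (hv : ContDiffAt ℝ 2 v z) (e e' : P) :
    localCovDeriv g c (localCovDeriv g c v e') e z =
      localCovDeriv g c (localCovDeriv g c v e) e' z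
        + localCurvature g (c z) (fderiv ℝ c z e) (fderiv ℝ c z e') (v z) := by
  rw [localCovDeriv_localCovDeriv hΓ hc hv, localCovDeriv_localCovDeriv hΓ hc hv,
    (hc.isSymmSndFDerivAt (by simp)).eq e e', (hv.isSymmSndFDerivAt (by simp)).eq e e',
    localCurvature]
  simp only [map_add]
  abel

end LocalConnection

/-! ### Tangent vectors and the metric in charts -/

section Charts

variable {E : Type*} [NormedAddCommGroup E] [NormedSpace ℝ E]
  {N : Type*} [TopologicalSpace N] [ChartedSpace E N]

lemma extChartAt_target_mem_nhds_of_mem {x : N} {y : E} (hy : y ∈ (extChartAt 𝓘(ℝ, E) x).target) :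
    (extChartAt 𝓘(ℝ, E) x).target ∈ 𝓝 y :=
  (isOpen_extChartAt_target x).mem_nhds hy

lemma chartMetric_apply [RiemannianBundle (fun q : N ↦ TangentSpace 𝓘(ℝ, E) q)]
    (x : N) (y v w : E) :
    chartMetric x y v w = inner ℝ (fromChart x y v) (fromChart x y w) := rfl

lemma chartMetric_symm [RiemannianBundle (fun q : N ↦ TangentSpace 𝓘(ℝ, E) q)]
    (x : N) (y v w : E) :
    chartMetric x y v w = chartMetric x y w v := by
  rw [chartMetric_apply, chartMetric_apply, real_inner_comm]

variable [IsManifold 𝓘(ℝ, E) ∞ N]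

lemma toChart_fromChart {x : N} {y : E} (hy : y ∈ (extChartAt 𝓘(ℝ, E) x).target) (v : E) :
    toChart x ((extChartAt 𝓘(ℝ, E) x).symm y) (fromChart x y v) = v := by
  have h := mfderiv_extChartAt_comp_mfderivWithin_extChartAt_symm (I := 𝓘(ℝ, E)) hy
  rw [modelWithCornersSelf_coe, range_id, mfderivWithin_univ] at h
  exact DFunLike.congr_fun h v

lemma toChart_fromChart' {x q : N} (hq : q ∈ (extChartAt 𝓘(ℝ, E) x).source) (v : E) :
    toChart x q (fromChart x (extChartAt 𝓘(ℝ, E) x q) v) = v := by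
  have h := mfderiv_extChartAt_comp_mfderivWithin_extChartAt_symm' (I := 𝓘(ℝ, E)) hq
  rw [modelWithCornersSelf_coe, range_id, mfderivWithin_univ] at h
  exact DFunLike.congr_fun h v

lemma fromChart_toChart {x q : N} (hq : q ∈ (extChartAt 𝓘(ℝ, E) x).source)
    (X : TangentSpace 𝓘(ℝ, E) q) :
    (fromChart x (extChartAt 𝓘(ℝ, E) x q) (toChart x q X) : TangentSpace 𝓘(ℝ, E) q) = X := by
  have h := mfderivWithin_extChartAt_symm_comp_mfderiv_extChartAt' (I := 𝓘(ℝ, E)) hq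
  rw [modelWithCornersSelf_coe, range_id, mfderivWithin_univ] at h
  exact DFunLike.congr_fun h X

lemma mdifferentiableAt_extChartAt_symm {x : N} {y : E}
    (hy : y ∈ (extChartAt 𝓘(ℝ, E) x).target) :
    MDifferentiableAt 𝓘(ℝ, E) 𝓘(ℝ, E) (extChartAt 𝓘(ℝ, E) x).symm y :=
  (mdifferentiableOn_extChartAt_symm y hy).mdifferentiableAt (extChartAt_target_mem_nhds_of_mem hy)

/-- The change of coordinates from the preferred chart around `x` to the one around `x'`. -/
def transition (x x' : N) (y : E) : E :=
  extChartAt 𝓘(ℝ, E) x' ((extChartAt 𝓘(ℝ, E) x).symm y)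

variable {x x' : N} {y : E}

lemma contDiffAt_transition (hy : y ∈ (extChartAt 𝓘(ℝ, E) x).target)
    (hy' : (extChartAt 𝓘(ℝ, E) x).symm y ∈ (extChartAt 𝓘(ℝ, E) x').source) :
    ContDiffAt ℝ ∞ (transition x x') y := by
  rw [← contMDiffAt_iff_contDiffAt]
  exact (contMDiffAt_extChartAt' (by simpa using hy')).comp y
    ((contMDiffOn_extChartAt_symm x).contMDiffAt (extChartAt_target_mem_nhds_of_mem hy))

lemma fderiv_transition (hy : y ∈ (extChartAt 𝓘(ℝ, E) x).target)
    (hy' : (extChartAt 𝓘(ℝ, E) x).symm y ∈ (extChartAt 𝓘(ℝ, E) x').source) (v : E) :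
    fderiv ℝ (transition x x') y v =
      toChart x' ((extChartAt 𝓘(ℝ, E) x).symm y) (fromChart x y v) := by
  have h := mfderiv_comp y (mdifferentiableAt_extChartAt (I := 𝓘(ℝ, E)) (x := x')
    (by simpa using hy')) (mdifferentiableAt_extChartAt_symm hy)
  have h' : mfderiv 𝓘(ℝ, E) 𝓘(ℝ, E) (transition x x') y = _ := h
  rw [mfderiv_eq_fderiv] at h'
  rw [h']
  rfl

variable {P : Type*} [NormedAddCommGroup P] [NormedSpace ℝ P] {u : P → N}
  {ξ η : ∀ z, TangentSpace 𝓘(ℝ, E) (u z)} {z : P}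

/-- A field along a map is smooth if and only if the map and the coordinates of the field are. -/
lemma contMDiffAt_field_iff (hx : u z ∈ (extChartAt 𝓘(ℝ, E) x).source) :
    ContMDiffAt 𝓘(ℝ, P) 𝓘(ℝ, E).tangent ∞
        (fun z ↦ (⟨u z, ξ z⟩ : TangentBundle 𝓘(ℝ, E) N)) z ↔
      ContMDiffAt 𝓘(ℝ, P) 𝓘(ℝ, E) ∞ u z ∧
        ContDiffAt ℝ ∞ (fun z ↦ toChart x (u z) (ξ z)) z := by
  have hx' : u z ∈ (chartAt E x).source := by simpa using hx
  rw [Trivialization.contMDiffAt_iff (e := trivializationAt E (TangentSpace 𝓘(ℝ, E)) x)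
    (f := fun z ↦ (⟨u z, ξ z⟩ : TangentBundle 𝓘(ℝ, E) N)) (by
      rw [TangentBundle.trivializationAt_source]
      exact hx')]
  refine and_congr_right fun hu ↦ ?_
  rw [contMDiffAt_iff_contDiffAt]
  suffices h : (fun z ↦ (trivializationAt E (TangentSpace 𝓘(ℝ, E)) x
      (⟨u z, ξ z⟩ : TangentBundle 𝓘(ℝ, E) N)).2) =ᶠ[𝓝 z] fun z ↦ toChart x (u z) (ξ z) from
    ⟨fun h' ↦ h'.congr_of_eventuallyEq h.symm, fun h' ↦ h'.congr_of_eventuallyEq h⟩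
  have hev : ∀ᶠ z' in 𝓝 z, u z' ∈ (chartAt E x).source :=
    hu.continuousAt.eventually ((chartAt E x).open_source.mem_nhds hx')
  filter_upwards [hev] with z' hz'
  rw [toChart, ← TangentBundle.continuousLinearMapAt_trivializationAt hz',
    Trivialization.continuousLinearMapAt_apply, Trivialization.linearMapAt_apply, if_pos]
  rw [TangentBundle.trivializationAt_baseSet]
  exact hz'

lemma contDiffAt_extChartAt_comp (hx : u z ∈ (extChartAt 𝓘(ℝ, E) x).source)
    (hu : ContMDiffAt 𝓘(ℝ, P) 𝓘(ℝ, E) ∞ u z) :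
    ContDiffAt ℝ ∞ (fun z ↦ extChartAt 𝓘(ℝ, E) x (u z)) z := by
  rw [← contMDiffAt_iff_contDiffAt]
  exact (contMDiffAt_extChartAt' (by simpa using hx)).comp z hu

lemma toChart_mfderiv (hx : u z ∈ (extChartAt 𝓘(ℝ, E) x).source)
    (hu : MDifferentiableAt 𝓘(ℝ, P) 𝓘(ℝ, E) u z) (e : P) :
    toChart x (u z) (mfderiv 𝓘(ℝ, P) 𝓘(ℝ, E) u z e) =
      fderiv ℝ (fun z ↦ extChartAt 𝓘(ℝ, E) x (u z)) z e := by
  have h := mfderiv_comp z (mdifferentiableAt_extChartAt (I := 𝓘(ℝ, E)) (x := x)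
    (by simpa using hx)) hu
  have h' : mfderiv 𝓘(ℝ, P) 𝓘(ℝ, E) (fun z ↦ extChartAt 𝓘(ℝ, E) x (u z)) z = _ := h
  rw [mfderiv_eq_fderiv] at h'
  rw [h']
  rfl

lemma contMDiffAt_fromChart (hy : y ∈ (extChartAt 𝓘(ℝ, E) x).target) (v : E) :
    ContMDiffAt 𝓘(ℝ, E) 𝓘(ℝ, E).tangent ∞
      (fun y ↦ (⟨(extChartAt 𝓘(ℝ, E) x).symm y, fromChart x y v⟩ : TangentBundle 𝓘(ℝ, E) N)) y := by
  rw [contMDiffAt_field_iff (x := x) ((extChartAt 𝓘(ℝ, E) x).map_target hy)]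
  refine ⟨(contMDiffOn_extChartAt_symm x).contMDiffAt (extChartAt_target_mem_nhds_of_mem hy),
    (contDiffAt_const (c := v)).congr_of_eventuallyEq ?_⟩
  filter_upwards [extChartAt_target_mem_nhds_of_mem hy] with y' hy'
  exact toChart_fromChart hy' v

variable [RiemannianBundle (fun q : N ↦ TangentSpace 𝓘(ℝ, E) q)]

lemma isInvertible_chartMetric [FiniteDimensional ℝ E]
    (hy : y ∈ (extChartAt 𝓘(ℝ, E) x).target) : (chartMetric x y).IsInvertible := by
  have hinj : Function.Injective (chartMetric x y) := by
    rw [injective_iff_map_eq_zero]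
    intro v hv
    have h1 : chartMetric x y v v = 0 := by rw [hv]; rfl
    rw [chartMetric_apply, inner_self_eq_zero] at h1
    rw [← toChart_fromChart hy v, h1, map_zero]
  have hdim : Module.finrank ℝ E = Module.finrank ℝ (E →L[ℝ] ℝ) := by
    rw [← (LinearMap.toContinuousLinearMap (𝕜 := ℝ) (E := E) (F' := ℝ)).finrank_eq]
    exact (Subspace.dual_finrank_eq).symm
  let e := LinearEquiv.ofInjectiveOfFinrankEq (chartMetric x y : E →ₗ[ℝ] E →L[ℝ] ℝ) hinj hdim
  exact ⟨e.toContinuousLinearEquiv, by ext v w; rfl⟩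

variable [IsContMDiffRiemannianBundle 𝓘(ℝ, E) ∞ E (fun q : N ↦ TangentSpace 𝓘(ℝ, E) q)]

lemma contDiffAt_chartMetric [FiniteDimensional ℝ E]
    (hy : y ∈ (extChartAt 𝓘(ℝ, E) x).target) : ContDiffAt ℝ ∞ (chartMetric x) y := by
  have h : ∀ v w, ContDiffOn ℝ ∞ (fun y ↦ chartMetric x y v w)
      (extChartAt 𝓘(ℝ, E) x).target := fun v w y hy ↦ by
    refine ContDiffAt.contDiffWithinAt ?_
    rw [← contMDiffAt_iff_contDiffAt]
    exact ContMDiffAt.inner_bundle (E := fun q : N ↦ TangentSpace 𝓘(ℝ, E) q)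
      (b := (extChartAt 𝓘(ℝ, E) x).symm) (v := fun y ↦ fromChart x y v)
      (w := fun y ↦ fromChart x y w) (contMDiffAt_fromChart hy v) (contMDiffAt_fromChart hy w)
  exact (contDiffOn_clm_apply.2 fun v ↦ contDiffOn_clm_apply.2 fun w ↦ h v w).contDiffAt
    (extChartAt_target_mem_nhds_of_mem hy)

end Charts

/-! ### The covariant derivative along a map -/

section CovariantDerivative

lemma localCovDeriv_congr {E P : Type*} [NormedAddCommGroup E] [NormedSpace ℝ E]
    [NormedAddCommGroup P] [NormedSpace ℝ P] {g : E → E →L[ℝ] E →L[ℝ] ℝ} {c v v' : P → E} {z : P}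
    (h : v =ᶠ[𝓝 z] v') (e : P) : localCovDeriv g c v e z = localCovDeriv g c v' e z := by
  rw [localCovDeriv, localCovDeriv, h.fderiv_eq, h.self_of_nhds]

variable {E : Type*} [NormedAddCommGroup E] [NormedSpace ℝ E]
  {N : Type*} [TopologicalSpace N] [ChartedSpace E N] [IsManifold 𝓘(ℝ, E) ∞ N]
  [RiemannianBundle (fun q : N ↦ TangentSpace 𝓘(ℝ, E) q)]

lemma chartMetric_toChart {x q : N} (hq : q ∈ (extChartAt 𝓘(ℝ, E) x).source)
    (X Y : TangentSpace 𝓘(ℝ, E) q) :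
    chartMetric x (extChartAt 𝓘(ℝ, E) x q) (toChart x q X) (toChart x q Y) = inner ℝ X Y := by
  -- The points `φ⁻¹ (φ q)` and `q` are equal only propositionally; generalizing over `q'` moves
  -- coordinate vectors between their tangent spaces.
  have key : ∀ q' : N, q' = q → ∀ V W : E,
      @inner ℝ (TangentSpace 𝓘(ℝ, E) q') _ V W = @inner ℝ (TangentSpace 𝓘(ℝ, E) q) _ V W := by
    rintro _ rfl _ _
    rfl
  rw [chartMetric_apply]
  refine (key _ ((extChartAt 𝓘(ℝ, E) x).left_inv hq) _ _).trans ?_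
  rw [fromChart_toChart hq, fromChart_toChart hq]

omit [RiemannianBundle (fun q : N ↦ TangentSpace 𝓘(ℝ, E) q)] in
lemma fderiv_transition_extChartAt {x x' q : N} (hq : q ∈ (extChartAt 𝓘(ℝ, E) x).source)
    (hq' : q ∈ (extChartAt 𝓘(ℝ, E) x').source) (v : E) :
    fderiv ℝ (transition x x') (extChartAt 𝓘(ℝ, E) x q) v =
      toChart x' q (fromChart x (extChartAt 𝓘(ℝ, E) x q) v) := by
  have key : ∀ q' : N, q' = q → ∀ V : E,
      toChart x' q' (V : TangentSpace 𝓘(ℝ, E) q') = toChart x' q (V : TangentSpace 𝓘(ℝ, E) q) := by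
    rintro _ rfl _
    rfl
  rw [fderiv_transition ((extChartAt 𝓘(ℝ, E) x).map_source hq)
    (by rwa [(extChartAt 𝓘(ℝ, E) x).left_inv hq])]
  exact key _ ((extChartAt 𝓘(ℝ, E) x).left_inv hq) _

lemma chartMetric_transition {x x' : N} {y : E} (hy : y ∈ (extChartAt 𝓘(ℝ, E) x).target)
    (hy' : (extChartAt 𝓘(ℝ, E) x).symm y ∈ (extChartAt 𝓘(ℝ, E) x').source) (v w : E) :
    chartMetric x y v w = chartMetric x' (transition x x' y) (fderiv ℝ (transition x x') y v)
      (fderiv ℝ (transition x x') y w) := by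
  rw [fderiv_transition hy hy', fderiv_transition hy hy', transition, chartMetric_toChart hy',
    chartMetric_apply]

variable {S : Set (ℝ × ℝ)} {u : ℝ × ℝ → N} {ξ η : ∀ z, TangentSpace 𝓘(ℝ, E) (u z)} {z : ℝ × ℝ}
  {x : N}

/-- The coordinates of a map in the preferred chart around `x`. -/
abbrev mapCoord (x : N) (u : ℝ × ℝ → N) (z : ℝ × ℝ) : E := extChartAt 𝓘(ℝ, E) x (u z)

/-- The coordinates of a vector field along a map in the preferred chart around `x`. -/
abbrev fieldCoord (x : N) (u : ℝ × ℝ → N) (ξ : ∀ z, TangentSpace 𝓘(ℝ, E) (u z)) (z : ℝ × ℝ) : E :=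
  toChart x (u z) (ξ z)

/-- Smoothness at a point of a vector field along a map. -/
abbrev SmoothFieldAt (u : ℝ × ℝ → N) (ξ : ∀ z, TangentSpace 𝓘(ℝ, E) (u z)) (z : ℝ × ℝ) : Prop :=
  ContMDiffAt 𝓘(ℝ, ℝ × ℝ) 𝓘(ℝ, E).tangent ∞
    (fun z ↦ (⟨u z, ξ z⟩ : TangentBundle 𝓘(ℝ, E) N)) z

omit [RiemannianBundle (fun q : N ↦ TangentSpace 𝓘(ℝ, E) q)]

lemma SmoothFieldAt.base (h : SmoothFieldAt u ξ z) :
    ContMDiffAt 𝓘(ℝ, ℝ × ℝ) 𝓘(ℝ, E) ∞ u z :=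
  ((contMDiffAt_field_iff (mem_extChartAt_source (u z))).1 h).1

lemma SmoothFieldAt.contDiffAt_mapCoord (h : SmoothFieldAt u ξ z)
    (hx : u z ∈ (extChartAt 𝓘(ℝ, E) x).source) : ContDiffAt ℝ ∞ (mapCoord (E := E) x u) z :=
  contDiffAt_extChartAt_comp hx h.base

lemma SmoothFieldAt.contDiffAt_fieldCoord (h : SmoothFieldAt u ξ z)
    (hx : u z ∈ (extChartAt 𝓘(ℝ, E) x).source) : ContDiffAt ℝ ∞ (fieldCoord x u ξ) z :=
  ((contMDiffAt_field_iff hx).1 h).2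

lemma SmoothFieldAt.eventually_mem (h : SmoothFieldAt u ξ z)
    (hx : u z ∈ (extChartAt 𝓘(ℝ, E) x).source) :
    ∀ᶠ z' in 𝓝 z, u z' ∈ (extChartAt 𝓘(ℝ, E) x).source :=
  h.base.continuousAt.eventually ((isOpen_extChartAt_source x).mem_nhds hx)

lemma toChart_mapDeriv (hS : S ∈ 𝓝 z) (hu : ContMDiffAt 𝓘(ℝ, ℝ × ℝ) 𝓘(ℝ, E) ∞ u z)
    (hx : u z ∈ (extChartAt 𝓘(ℝ, E) x).source) (e : ℝ × ℝ) :
    toChart x (u z) (mapDeriv S u e z) = fderiv ℝ (mapCoord (E := E) x u) z e := by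
  rw [mapDeriv, mfderivWithin_of_mem_nhds hS]
  exact toChart_mfderiv hx (hu.mdifferentiableAt (by simp)) e

variable [RiemannianBundle (fun q : N ↦ TangentSpace 𝓘(ℝ, E) q)]

lemma covDeriv_eq (hS : S ∈ 𝓝 z) (hξ : SmoothFieldAt u ξ z) (e : ℝ × ℝ) :
    covDeriv S u e ξ z = fromChart (u z) (extChartAt 𝓘(ℝ, E) (u z) (u z))
      (localCovDeriv (chartMetric (u z)) (mapCoord (u z) u) (fieldCoord (u z) u ξ) e z) := by
  rw [covDeriv, fderivWithin_of_mem_nhds hS,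
    toChart_mapDeriv hS hξ.base (mem_extChartAt_source (u z)), localCovDeriv, christoffelMap_apply]
  rfl

variable [FiniteDimensional ℝ E]
  [IsContMDiffRiemannianBundle 𝓘(ℝ, E) ∞ E (fun q : N ↦ TangentSpace 𝓘(ℝ, E) q)]

/-- The covariant derivative may be computed in any chart. -/
lemma toChart_covDeriv (hS : S ∈ 𝓝 z) (hξ : SmoothFieldAt u ξ z)
    (hx : u z ∈ (extChartAt 𝓘(ℝ, E) x).source) (e : ℝ × ℝ) :
    toChart x (u z) (covDeriv S u e ξ z) =
      localCovDeriv (chartMetric x) (mapCoord x u) (fieldCoord x u ξ) e z := by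
  have h0 := mem_extChartAt_source (I := 𝓘(ℝ, E)) (u z)
  have hy := (extChartAt 𝓘(ℝ, E) (u z)).map_source h0
  have hinv := (extChartAt 𝓘(ℝ, E) (u z)).left_inv h0
  have hy' : (extChartAt 𝓘(ℝ, E) (u z)).symm (extChartAt 𝓘(ℝ, E) (u z) (u z)) ∈
      (extChartAt 𝓘(ℝ, E) x).source := by rwa [hinv]
  have htr : transition (u z) x (extChartAt 𝓘(ℝ, E) (u z) (u z)) = extChartAt 𝓘(ℝ, E) x (u z) := by
    rw [transition, hinv]
  have hxt := (extChartAt 𝓘(ℝ, E) x).map_source hx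
  rw [covDeriv_eq hS hξ]
  refine (fderiv_transition_extChartAt h0 hx _).symm.trans (Eq.symm ?_)
  refine fderiv_localCovDeriv (c := mapCoord (u z) u) (z := z)
    ((contDiffAt_chartMetric hy).differentiableAt (by simp))
    ?_ ((contDiffAt_transition hy hy').of_le (by norm_cast)) ?_
    (fun v w ↦ chartMetric_symm x _ v w) (isInvertible_chartMetric hy) ?_ ?_
    ((hξ.contDiffAt_mapCoord h0).differentiableAt (by simp))
    ((hξ.contDiffAt_fieldCoord h0).differentiableAt (by simp))
    ?_ ?_ e
  · rw [htr]
    exact (contDiffAt_chartMetric hxt).differentiableAt (by simp)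
  · have hc : ContinuousAt (extChartAt 𝓘(ℝ, E) (u z)).symm (extChartAt 𝓘(ℝ, E) (u z) (u z)) :=
      continuousAt_extChartAt_symm (u z)
    filter_upwards [extChartAt_target_mem_nhds_of_mem hy,
      hc.eventually ((isOpen_extChartAt_source x).mem_nhds hy')] with y' h1 h2 v w
    exact chartMetric_transition h1 h2 v w
  · rw [htr]
    exact isInvertible_chartMetric hxt
  · intro v
    refine ⟨toChart (u z) (u z) (fromChart x (extChartAt 𝓘(ℝ, E) x (u z)) v), ?_⟩
    refine (fderiv_transition_extChartAt h0 hx _).trans ?_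
    exact (congrArg (toChart x (u z)) (fromChart_toChart h0 _)).trans (toChart_fromChart' hx v)
  · filter_upwards [hξ.eventually_mem h0] with z' hz'
    rw [transition, (extChartAt 𝓘(ℝ, E) (u z)).left_inv hz']
  · filter_upwards [hξ.eventually_mem h0, hξ.eventually_mem hx] with z' hz' hz''
    rw [fderiv_transition_extChartAt hz' hz'', fromChart_toChart hz']

/-- The chart in `covDeriv` jumps with the point, so smoothness is invisible in the definition; by
chart independence, the single chart around `u z` serves for all nearby points. -/
lemma smoothFieldAt_covDeriv {U : Set (ℝ × ℝ)} (hU : IsOpen U) (hUS : U ⊆ S)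
    (hξ : ∀ z ∈ U, SmoothFieldAt u ξ z) (e : ℝ × ℝ) :
    ∀ z ∈ U, SmoothFieldAt u (covDeriv S u e ξ) z := by
  intro z hz
  have h0 := mem_extChartAt_source (I := 𝓘(ℝ, E)) (u z)
  have hy := (extChartAt 𝓘(ℝ, E) (u z)).map_source h0
  refine (contMDiffAt_field_iff h0).2 ⟨(hξ z hz).base, ?_⟩
  have h := contDiffAt_localCovDeriv (g := chartMetric (u z)) (c := mapCoord (u z) u)
    (v := fieldCoord (u z) u ξ) (contDiffAt_chartMetric hy)
    (isInvertible_chartMetric hy) ((hξ z hz).contDiffAt_mapCoord h0)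
    ((hξ z hz).contDiffAt_fieldCoord h0) e
  refine h.congr_of_eventuallyEq ?_
  filter_upwards [(hξ z hz).eventually_mem h0, hU.mem_nhds hz] with z' h1 h2
  exact toChart_covDeriv (mem_of_superset (hU.mem_nhds h2) hUS) (hξ z' h2) h1 e

omit [FiniteDimensional ℝ E] in
lemma SmoothFieldAt.contDiffAt_inner (hξ : SmoothFieldAt u ξ z) (hη : SmoothFieldAt u η z) :
    ContDiffAt ℝ ∞ (fun z ↦ inner ℝ (ξ z) (η z)) z := by
  rw [← contMDiffAt_iff_contDiffAt]
  exact ContMDiffAt.inner_bundle (E := fun q : N ↦ TangentSpace 𝓘(ℝ, E) q) (b := u) hξ hη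

/-- The Levi-Civita connection is metric. -/
lemma fderiv_inner_field (hS : S ∈ 𝓝 z) (hξ : SmoothFieldAt u ξ z) (hη : SmoothFieldAt u η z)
    (e : ℝ × ℝ) :
    fderiv ℝ (fun z ↦ inner ℝ (ξ z) (η z)) z e =
      inner ℝ (covDeriv S u e ξ z) (η z) + inner ℝ (ξ z) (covDeriv S u e η z) := by
  have h0 := mem_extChartAt_source (I := 𝓘(ℝ, E)) (u z)
  have hy := (extChartAt 𝓘(ℝ, E) (u z)).map_source h0
  have h : (fun z ↦ inner ℝ (ξ z) (η z)) =ᶠ[𝓝 z] fun z' ↦ chartMetric (u z) (mapCoord (u z) u z')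
      (fieldCoord (u z) u ξ z') (fieldCoord (u z) u η z') := by
    filter_upwards [hξ.eventually_mem h0] with z' hz'
    exact (chartMetric_toChart hz' _ _).symm
  rw [h.fderiv_eq, fderiv_metric_localCovDeriv (g := chartMetric (u z)) (c := mapCoord (u z) u)
    ((contDiffAt_chartMetric hy).differentiableAt (by simp))
    (Eventually.of_forall fun y v w ↦ chartMetric_symm _ y v w) (isInvertible_chartMetric hy)
    ((hξ.contDiffAt_mapCoord h0).differentiableAt (by simp))
    ((hξ.contDiffAt_fieldCoord h0).differentiableAt (by simp))
    ((hη.contDiffAt_fieldCoord h0).differentiableAt (by simp)) e,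
    ← toChart_covDeriv hS hξ h0, ← toChart_covDeriv hS hη h0, chartMetric_toChart h0,
    chartMetric_toChart h0]

/-! ### Curvature -/

/-- The Christoffel map is differentiable at the centre of the chart, so evaluation at fixed vectors
commutes with its derivative. This makes trilinearity and the commutation formula available. -/
lemma chartCurvature_eq (x : N) (v w z : E) :
    chartCurvature x v w z = localCurvature (chartMetric x) (extChartAt 𝓘(ℝ, E) x x) v w z := by
  have hy := mem_extChartAt_target (I := 𝓘(ℝ, E)) x
  have hΓ : ∀ a b c : E, fderiv ℝ (fun y ↦ christoffel x y a b) (extChartAt 𝓘(ℝ, E) x x) c =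
      fderiv ℝ (christoffelMap (chartMetric x)) (extChartAt 𝓘(ℝ, E) x x) c a b := by
    intro a b c
    have hd := ((contDiffAt_christoffelMap (contDiffAt_chartMetric hy)
      (isInvertible_chartMetric hy)).differentiableAt (by simp)).hasFDerivAt
    have h : HasFDerivAt (fun y ↦ christoffelMap (chartMetric x) y a b) _ _ :=
      (hd.clm_apply (hasFDerivAt_const a _)).clm_apply (hasFDerivAt_const b _)
    have h' : (fun y ↦ christoffel x y a b) = fun y ↦ christoffelMap (chartMetric x) y a b :=
      funext fun y ↦ (christoffelMap_apply (chartMetric x) y a b).symm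
    rw [h', h.fderiv]
    simp
  have hc : ∀ a b : E, christoffel x (extChartAt 𝓘(ℝ, E) x x) a b =
      christoffelMap (chartMetric x) (extChartAt 𝓘(ℝ, E) x x) a b := fun a b ↦
    (christoffelMap_apply (chartMetric x) _ a b).symm
  simp only [chartCurvature, localCurvature, hΓ, hc]

lemma curvature_smul (x : N) (X Y Z : TangentSpace 𝓘(ℝ, E) x) (a b c : ℝ) :
    curvature x (a • X) (b • Y) (c • Z) = (a * b * c) • curvature x X Y Z := by
  have h : ∀ v w z : E, chartCurvature x (a • v) (b • w) (c • z) =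
      (a * b * c) • chartCurvature x v w z := by
    intro v w z
    rw [chartCurvature_eq, chartCurvature_eq]
    simp only [localCurvature, map_smul, smul_apply, smul_add, smul_sub, smul_smul]
    congr 1
    · congr 1
      · congr 1
        · congr 1; ring
        · congr 1; ring
      · congr 1; ring
    · congr 1; ring
  rw [curvature, map_smul, map_smul, map_smul]
  refine (congrArg _ (h _ _ _)).trans ?_
  exact map_smul _ _ _

/-- Trilinearity reduces the claim to vectors of norm at most one; the convention `0⁻¹ = 0` lets the
rescaling cover zero vectors too. -/
lemma norm_curvature_le {K : ℝ≥0} (hK : curvatureSupNorm E N ≤ K) (x : N)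
    (X Y Z : TangentSpace 𝓘(ℝ, E) x) : ‖curvature x X Y Z‖ ≤ K * ‖X‖ * ‖Y‖ * ‖Z‖ := by
  have hunit : ∀ X Y Z : TangentSpace 𝓘(ℝ, E) x, ‖X‖ ≤ 1 → ‖Y‖ ≤ 1 → ‖Z‖ ≤ 1 →
      ‖curvature x X Y Z‖ ≤ K := by
    intro X Y Z hX hY hZ
    have h : ‖curvature x X Y Z‖ₑ ≤ K := le_trans (by
      rw [curvatureSupNorm]
      exact le_iSup_of_le x <| le_iSup_of_le X <| le_iSup_of_le Y <| le_iSup_of_le Z <|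
        le_iSup_of_le hX <| le_iSup_of_le hY <| le_iSup_of_le hZ le_rfl) hK
    rw [← ofReal_norm, ENNReal.ofReal_le_iff_le_toReal ENNReal.coe_ne_top] at h
    exact h
  have hself : ∀ X : TangentSpace 𝓘(ℝ, E) x, ‖X‖ • (‖X‖⁻¹ • X) = X := by
    intro X
    rcases eq_or_ne X 0 with rfl | hX
    · simp
    · exact smul_inv_smul₀ (norm_ne_zero_iff.2 hX) X
  have hle : ∀ X : TangentSpace 𝓘(ℝ, E) x, ‖‖X‖⁻¹ • X‖ ≤ 1 := by
    intro X
    rw [norm_smul, norm_inv, norm_norm]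
    exact inv_mul_le_one
  calc ‖curvature x X Y Z‖ = ‖X‖ * ‖Y‖ * ‖Z‖ *
        ‖curvature x (‖X‖⁻¹ • X) (‖Y‖⁻¹ • Y) (‖Z‖⁻¹ • Z)‖ := by
        conv_lhs => rw [← hself X, ← hself Y, ← hself Z, curvature_smul, norm_smul]
        simp
    _ ≤ ‖X‖ * ‖Y‖ * ‖Z‖ * K := by
        gcongr
        exact hunit _ _ _ (hle X) (hle Y) (hle Z)
    _ = K * ‖X‖ * ‖Y‖ * ‖Z‖ := by ring

/-- The Ricci identity along a map. -/
lemma covDeriv_comm {U : Set (ℝ × ℝ)} (hU : IsOpen U) (hUS : U ⊆ S)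
    (hξ : ∀ z ∈ U, SmoothFieldAt u ξ z) (hz : z ∈ U) (e e' : ℝ × ℝ) :
    covDeriv S u e (covDeriv S u e' ξ) z = covDeriv S u e' (covDeriv S u e ξ) z
      + curvature (u z) (mapDeriv S u e z) (mapDeriv S u e' z) (ξ z) := by
  have h0 := mem_extChartAt_source (I := 𝓘(ℝ, E)) (u z)
  have hy := (extChartAt 𝓘(ℝ, E) (u z)).map_source h0
  have hS : ∀ z ∈ U, S ∈ 𝓝 z := fun z hz ↦ mem_of_superset (hU.mem_nhds hz) hUS
  have hev : ∀ e, fieldCoord (u z) u (covDeriv S u e ξ) =ᶠ[𝓝 z]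
      localCovDeriv (chartMetric (u z)) (mapCoord (u z) u) (fieldCoord (u z) u ξ) e := by
    intro e
    filter_upwards [(hξ z hz).eventually_mem h0, hU.mem_nhds hz] with z' h1 h2
    exact toChart_covDeriv (hS z' h2) (hξ z' h2) h1 e
  have hΓ := (contDiffAt_christoffelMap (contDiffAt_chartMetric hy)
    (isInvertible_chartMetric hy)).differentiableAt (by simp)
  have hcomm := localCovDeriv_comm (c := mapCoord (u z) u) (z := z) hΓ
    (((hξ z hz).contDiffAt_mapCoord h0).of_le (by norm_cast))
    (((hξ z hz).contDiffAt_fieldCoord h0).of_le (by norm_cast))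
    e e'
  rw [covDeriv_eq (hS z hz) (smoothFieldAt_covDeriv hU hUS hξ e' z hz),
    covDeriv_eq (hS z hz) (smoothFieldAt_covDeriv hU hUS hξ e z hz),
    localCovDeriv_congr (hev e'), localCovDeriv_congr (hev e), hcomm, curvature,
    chartCurvature_eq, toChart_mapDeriv (hS z hz) (hξ z hz).base h0,
    toChart_mapDeriv (hS z hz) (hξ z hz).base h0]
  exact map_add _ _ _

end CovariantDerivative

/-! ### Scalar estimates -/

section Scalar

/-- A crude form of Young's inequality: the product is at most the `p`-th power of the larger
factor. -/
lemma rpow_sub_one_mul_le {p x y : ℝ} (hp : 1 ≤ p) (hx : 0 ≤ x) (hy : 0 ≤ y) :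
    x ^ (p - 1) * y ≤ x ^ p + y ^ p := by
  have hmul : ∀ z : ℝ, 0 ≤ z → z ^ (p - 1) * z = z ^ p := fun z hz ↦ by
    conv_lhs => rw [← Real.rpow_one z, ← Real.rpow_mul hz,
      ← Real.rpow_add_of_nonneg hz (by linarith) (by linarith)]
    ring_nf
  have h0 : 0 ≤ p - 1 := by linarith
  rcases le_total x y with h | h
  · calc x ^ (p - 1) * y ≤ y ^ (p - 1) * y := by gcongr
      _ = y ^ p := hmul y hy
      _ ≤ x ^ p + y ^ p := le_add_of_nonneg_left (by positivity)
  · calc x ^ (p - 1) * y ≤ x ^ (p - 1) * x := by gcongr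
      _ = x ^ p := hmul x hx
      _ ≤ x ^ p + y ^ p := le_add_of_nonneg_right (by positivity)

lemma rpow_sub_two_mul_mul_le {p x y z : ℝ} (hp : 2 ≤ p) (hx : 0 ≤ x) (hy : 0 ≤ y) (hz : 0 ≤ z) :
    x ^ (p - 2) * (y * z) ≤ x ^ p + y ^ p + z ^ p := by
  have h0 : 0 ≤ p - 2 := by linarith
  have hM : ∀ M : ℝ, 0 ≤ M → x ≤ M → y ≤ M → z ≤ M → x ^ (p - 2) * (y * z) ≤ M ^ p := by
    intro M hM h1 h2 h3
    calc x ^ (p - 2) * (y * z) ≤ M ^ (p - 2) * (M * M) := by gcongr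
      _ = M ^ (p - 2) * M ^ (2 : ℝ) := by rw [Real.rpow_two, sq]
      _ = M ^ p := by rw [← Real.rpow_add_of_nonneg hM h0 (by norm_num)]; ring_nf
  have hx' := Real.rpow_nonneg hx p
  have hy' := Real.rpow_nonneg hy p
  have hz' := Real.rpow_nonneg hz p
  rcases le_total x y with h | h <;> rcases le_total y z with h' | h' <;>
    rcases le_total x z with h'' | h''
  all_goals first
    | (have := hM z hz h'' h' le_rfl; linarith)
    | (have := hM y hy h le_rfl h'; linarith)
    | (have := hM x hx le_rfl h h''; linarith)
    | (have := hM z hz (h.trans h') h' le_rfl; linarith)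
    | (have := hM x hx le_rfl h (h'.trans h); linarith)

lemma add_rpow_le {r x y : ℝ} (hr : 0 ≤ r) (hx : 0 ≤ x) (hy : 0 ≤ y) :
    (x + y) ^ r ≤ 2 ^ r * (x ^ r + y ^ r) := by
  have hx' := Real.rpow_nonneg hx r
  have hy' := Real.rpow_nonneg hy r
  have h2 : (0 : ℝ) < 2 ^ r := by positivity
  rcases le_total x y with h | h
  · calc (x + y) ^ r ≤ (2 * y) ^ r := by gcongr; linarith
      _ = 2 ^ r * y ^ r := Real.mul_rpow (by norm_num) hy
      _ ≤ _ := by gcongr; linarith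
  · calc (x + y) ^ r ≤ (2 * x) ^ r := by gcongr; linarith
      _ = 2 ^ r * x ^ r := Real.mul_rpow (by norm_num) hx
      _ ≤ _ := by gcongr; linarith

/-- Used with `B = √(A² + ε)`, `d = ½ ∂_s A² - ∂_t g` and `q = ∂_t A²`. Since `|g q| ≤ 2 B² m w`,
the possibly singular factor `B^(p-4)` turns into `B^(p-2)`, and the coefficients of `B^(p-2) m w`
add up to `p + p (p - 2) = p (p - 1)`. -/
lemma flux_bound {p κ A B m w x d g q : ℝ} (hp : 2 ≤ p) (hκ : 0 ≤ κ) (hB : 0 < B) (hA : 0 ≤ A)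
    (hAB : A ≤ B) (hm : 0 ≤ m) (hw : 0 ≤ w) (hx : 0 ≤ x) (hd : |d| ≤ m * w + κ * A * x)
    (hg : |g| ≤ A * w) (hq : |q| ≤ 2 * A * m) :
    |p * B ^ (p - 2) * d - p * (p / 2 - 1) * B ^ (p - 4) * (g * q)| ≤
      (p * (p - 1) + p * κ) * (B ^ p + m ^ p + w ^ p + x ^ p) := by
  have h4 : B ^ (p - 4) * (B * B) = B ^ (p - 2) := by
    rw [← sq, ← Real.rpow_two, ← Real.rpow_add hB]; ring_nf
  have h2 : B ^ (p - 2) * B = B ^ (p - 1) := by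
    conv_lhs => rw [← Real.rpow_one B, ← Real.rpow_mul hB.le, ← Real.rpow_add hB]
    ring_nf
  have hp2 : 0 ≤ p / 2 - 1 := by linarith
  have hp0 : 0 ≤ p := by linarith
  have hgq : |g * q| ≤ 2 * (B * B) * (m * w) := by
    rw [abs_mul]
    calc |g| * |q| ≤ (A * w) * (2 * A * m) := by gcongr
      _ ≤ (B * w) * (2 * B * m) := by gcongr
      _ = _ := by ring
  have hxp := Real.rpow_nonneg hx p
  have hmp := Real.rpow_nonneg hm p
  have hwp := Real.rpow_nonneg hw p
  have hBp := Real.rpow_nonneg hB.le p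
  calc |p * B ^ (p - 2) * d - p * (p / 2 - 1) * B ^ (p - 4) * (g * q)|
      ≤ |p * B ^ (p - 2) * d| + |p * (p / 2 - 1) * B ^ (p - 4) * (g * q)| := abs_sub _ _
    _ = p * B ^ (p - 2) * |d| + p * (p / 2 - 1) * B ^ (p - 4) * |g * q| := by
        rw [abs_mul, abs_mul (p * (p / 2 - 1) * B ^ (p - 4)),
          abs_of_nonneg (a := p * B ^ (p - 2)) (by positivity),
          abs_of_nonneg (a := p * (p / 2 - 1) * B ^ (p - 4)) (by positivity)]
    _ ≤ p * B ^ (p - 2) * (m * w + κ * B * x)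
        + p * (p / 2 - 1) * B ^ (p - 4) * (2 * (B * B) * (m * w)) := by
        gcongr
        exact hd.trans (by gcongr)
    _ = p * (p - 1) * (B ^ (p - 2) * (m * w)) + p * κ * (B ^ (p - 1) * x) := by
        rw [← h2]
        linear_combination (p * (p / 2 - 1) * 2 * (m * w)) * h4
    _ ≤ p * (p - 1) * (B ^ p + m ^ p + w ^ p + x ^ p)
        + p * κ * (B ^ p + m ^ p + w ^ p + x ^ p) := by
        have : 0 ≤ p - 1 := by linarith
        gcongr
        · linarith [rpow_sub_two_mul_mul_le hp hB.le hm hw]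
        · linarith [rpow_sub_one_mul_le (by linarith : 1 ≤ p) hB.le hx]
    _ = _ := by ring

/-- The one-dimensional Sobolev inequality on the unit interval. -/
lemma le_integral_add_of_hasDerivAt {f f' h : ℝ → ℝ}
    (hf : ∀ t ∈ Icc (0 : ℝ) 1, HasDerivAt f (f' t) t)
    (hf' : ContinuousOn f' (Icc 0 1)) (hh : ContinuousOn h (Icc 0 1))
    (hle : ∀ t ∈ Icc (0 : ℝ) 1, |f' t| ≤ h t) {t : ℝ} (ht : t ∈ Icc (0 : ℝ) 1) :
    f t ≤ ∫ t in (0 : ℝ)..1, (f t + h t) := by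
  have hfc : ContinuousOn f (Icc 0 1) := fun t ht ↦ (hf t ht).continuousAt.continuousWithinAt
  have hii : ∀ {k : ℝ → ℝ}, ContinuousOn k (Icc 0 1) → IntervalIntegrable k volume 0 1 :=
    fun hk ↦ ContinuousOn.intervalIntegrable (by rwa [uIcc_of_le zero_le_one])
  -- The value at `t` exceeds the value at any other `t'` by at most the total variation; averaging
  -- over `t'` then gives the claim.
  have key : ∀ t' ∈ Icc (0 : ℝ) 1, f t - ∫ t in (0 : ℝ)..1, h t ≤ f t' := by
    intro t' ht'
    have hsub : uIcc t' t ⊆ Icc 0 1 := uIcc_subset_Icc ht' ht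
    have h1 : ∫ y in t'..t, f' y = f t - f t' :=
      intervalIntegral.integral_eq_sub_of_hasDerivAt (fun y hy ↦ hf y (hsub hy))
        (hf'.mono hsub).intervalIntegrable
    have h2 : |∫ y in t'..t, f' y| ≤ |∫ y in t'..t, h y| := by
      refine intervalIntegral.norm_integral_le_abs_of_norm_le (E := ℝ) (μ := volume) ?_
        (hh.mono hsub).intervalIntegrable
      filter_upwards [ae_restrict_mem measurableSet_uIoc] with y hy
      exact hle y (hsub (uIoc_subset_uIcc hy))
    have hnn : ∀ y ∈ Icc (0 : ℝ) 1, 0 ≤ h y := fun y hy ↦ (abs_nonneg _).trans (hle y hy)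
    have h3 : |∫ y in t'..t, h y| ≤ |∫ y in (0 : ℝ)..1, h y| := by
      refine intervalIntegral.abs_integral_mono_interval ?_ ?_ (hii hh)
      · rw [uIoc_of_le zero_le_one]
        rintro y hy
        have := uIoc_subset_uIcc hy
        rcases le_total t' t with h | h
        · rw [uIoc_of_le h] at hy
          exact ⟨ht'.1.trans_lt hy.1, hy.2.trans ht.2⟩
        · rw [uIoc_of_ge h] at hy
          exact ⟨ht.1.trans_lt hy.1, hy.2.trans ht'.2⟩
      · rw [uIoc_of_le zero_le_one]
        filter_upwards [ae_restrict_mem measurableSet_Ioc] with y hy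
        exact hnn y (Ioc_subset_Icc_self hy)
    rw [abs_of_nonneg (a := ∫ y in (0 : ℝ)..1, h y)
      (intervalIntegral.integral_nonneg zero_le_one hnn)] at h3
    have := le_abs_self (∫ y in t'..t, f' y)
    linarith
  have h4 : ∫ _ in (0 : ℝ)..1, (f t - ∫ t in (0 : ℝ)..1, h t) ≤ ∫ t in (0 : ℝ)..1, f t :=
    intervalIntegral.integral_mono_on zero_le_one intervalIntegrable_const (hii hfc) key
  rw [intervalIntegral.integral_const] at h4
  rw [intervalIntegral.integral_add (hii hfc) (hii hh)]
  simp only [sub_zero, one_smul] at h4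
  linarith

/-- The divergence theorem on a cylinder, for a power of a positive function `r` whose `s`-derivative
is controlled up to a `t`-derivative. -/
lemma integral_rpow_le_of_flux_le {a b p : ℝ} {r g H : ℝ × ℝ → ℝ}
    (hr : ContDiffOn ℝ 1 r (Ioo a b ×ˢ univ)) (hg : ContDiffOn ℝ 1 g (Ioo a b ×ˢ univ))
    (hH : ContinuousOn H (Ioo a b ×ˢ univ)) (hr0 : ∀ z, 0 < r z)
    (hrp : ∀ s ∈ Ioo a b, r (s, 1) = r (s, 0)) (hgp : ∀ s ∈ Ioo a b, g (s, 1) = g (s, 0))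
    (hle : ∀ z ∈ Ioo a b ×ˢ univ,
      p * r z ^ (p / 2 - 1) * (1 / 2 * fderiv ℝ r z (1, 0) - fderiv ℝ g z (0, 1))
        - p * (p / 2 - 1) * r z ^ (p / 2 - 1 - 1) * (g z * fderiv ℝ r z (0, 1)) ≤ H z)
    {a' s : ℝ} (ha' : a < a') (hs : a' ≤ s) (hsb : s < b) :
    ∫ t in (0 : ℝ)..1, r (s, t) ^ (p / 2) ≤
      (∫ t in (0 : ℝ)..1, r (a', t) ^ (p / 2)) + ∫ z in Icc (a', (0 : ℝ)) (s, 1), H z := by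
  have hU : IsOpen (Ioo a b ×ˢ (univ : Set ℝ)) := isOpen_Ioo.prod isOpen_univ
  have hR : Icc (a', (0 : ℝ)) (s, 1) ⊆ Ioo a b ×ˢ univ := fun z hz ↦
    ⟨⟨ha'.trans_le hz.1.1, hz.2.1.trans_lt hsb⟩, trivial⟩
  have hsub : Ioo a' s ×ˢ Ioo (0 : ℝ) 1 ⊆ Ioo a b ×ˢ univ := fun z hz ↦
    ⟨⟨ha'.trans hz.1.1, hz.1.2.trans hsb⟩, trivial⟩
  have hf : ContDiffOn ℝ 1 (fun z ↦ r z ^ (p / 2)) (Ioo a b ×ˢ univ) :=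
    hr.rpow_const_of_ne fun z _ ↦ (hr0 z).ne'
  -- The field `(r^(p/2), -p r^(p/2-1) g)` has as divergence precisely the left-hand side of `hle`.
  have hG : ContDiffOn ℝ 1 (fun z ↦ -p * (r z ^ (p / 2 - 1) * g z)) (Ioo a b ×ˢ univ) :=
    contDiffOn_const.mul ((hr.rpow_const_of_ne fun z _ ↦ (hr0 z).ne').mul hg)
  have hd : ∀ {k : ℝ × ℝ → ℝ}, ContDiffOn ℝ 1 k (Ioo a b ×ˢ univ) →
      ∀ z ∈ Ioo a b ×ˢ univ, HasFDerivAt k (fderiv ℝ k z) z := fun hk z hz ↦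
    ((hk.contDiffAt (hU.mem_nhds hz)).differentiableAt (by simp)).hasFDerivAt
  have hc : ∀ {k : ℝ × ℝ → ℝ}, ContDiffOn ℝ 1 k (Ioo a b ×ˢ univ) →
      ∀ e, ContinuousOn (fun z ↦ fderiv ℝ k z e) (Ioo a b ×ˢ univ) := fun hk e ↦
    (hk.continuousOn_fderiv_of_isOpen hU le_rfl).clm_apply continuousOn_const
  have hint : ∀ {k : ℝ × ℝ → ℝ}, ContinuousOn k (Ioo a b ×ˢ univ) →
      IntegrableOn k (Icc (a', (0 : ℝ)) (s, 1)) := fun hk ↦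
    (hk.mono hR).integrableOn_compact isCompact_Icc
  have hi : IntegrableOn (fun z ↦ fderiv ℝ (fun z ↦ r z ^ (p / 2)) z (1, 0)
      + fderiv ℝ (fun z ↦ -p * (r z ^ (p / 2 - 1) * g z)) z (0, 1))
      (Icc (a', (0 : ℝ)) (s, 1)) := hint ((hc hf (1, 0)).add (hc hG (0, 1)))
  have hdiv := integral_divergence_prod_Icc_of_hasFDerivAt_of_le _ _ _ _ (a', (0 : ℝ)) (s, 1)
    ⟨hs, zero_le_one⟩ (hf.continuousOn.mono hR) (hG.continuousOn.mono hR)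
    (fun z hz ↦ hd hf z (hsub hz)) (fun z hz ↦ hd hG z (hsub hz)) hi
  -- Periodicity: the fluxes through the sides `t = 0` and `t = 1` cancel.
  have hper : ∫ y in a'..s, -p * (r (y, 1) ^ (p / 2 - 1) * g (y, 1)) =
      ∫ y in a'..s, -p * (r (y, 0) ^ (p / 2 - 1) * g (y, 0)) := by
    refine intervalIntegral.integral_congr fun y hy ↦ ?_
    rw [uIcc_of_le hs] at hy
    have hy' : y ∈ Ioo a b := ⟨ha'.trans_le hy.1, hy.2.trans_lt hsb⟩
    simp only [hrp y hy', hgp y hy']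
  rw [hper, sub_self, zero_add] at hdiv
  have hmono := setIntegral_mono_on hi (hint hH) measurableSet_Icc fun z hz ↦ by
    have hzU := hR hz
    refine le_trans (le_of_eq ?_) (hle z hzU)
    have h1 := (hd hr z hzU).rpow_const (p := p / 2) (Or.inl (hr0 z).ne')
    have h2 := ((((hd hr z hzU).rpow_const (p := p / 2 - 1) (Or.inl (hr0 z).ne')).mul
        (hd hg z hzU)).const_mul (-p))
    have h2' : fderiv ℝ (fun z ↦ -p * (r z ^ (p / 2 - 1) * g z)) z = _ := h2.fderiv
    rw [h1.fderiv, h2']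
    simp only [smul_apply, add_apply, smul_eq_mul]
    ring
  rw [hdiv] at hmono
  linarith

/-- A parabolic trace estimate: the `L^p` norm on a circle `{s} × S¹` of a function `A` that vanishes
for `s = a'` is controlled if half the `s`-derivative of `A ^ 2` is, up to controlled terms, the
`t`-derivative of a function `g`. -/
lemma trace_estimate {a b p κ : ℝ} (hp : 2 ≤ p) (hκ : 0 ≤ κ) {A g m w x : ℝ × ℝ → ℝ}
    (hA : ContDiffOn ℝ 1 (fun z ↦ A z ^ 2) (Ioo a b ×ˢ univ))
    (hg : ContDiffOn ℝ 1 g (Ioo a b ×ˢ univ))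
    (hm : ContinuousOn m (Ioo a b ×ˢ univ)) (hw : ContinuousOn w (Ioo a b ×ˢ univ))
    (hx : ContinuousOn x (Ioo a b ×ˢ univ))
    (hA0 : ∀ z, 0 ≤ A z) (hm0 : ∀ z, 0 ≤ m z) (hw0 : ∀ z, 0 ≤ w z) (hx0 : ∀ z, 0 ≤ x z)
    (hAt : ∀ z ∈ Ioo a b ×ˢ univ, |fderiv ℝ (fun z ↦ A z ^ 2) z (0, 1)| ≤ 2 * A z * m z)
    (hgw : ∀ z ∈ Ioo a b ×ˢ univ, |g z| ≤ A z * w z)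
    (hd : ∀ z ∈ Ioo a b ×ˢ univ,
      |1 / 2 * fderiv ℝ (fun z ↦ A z ^ 2) z (1, 0) - fderiv ℝ g z (0, 1)| ≤
        m z * w z + κ * A z * x z)
    (hAp : ∀ s ∈ Ioo a b, A (s, 1) = A (s, 0)) (hgp : ∀ s ∈ Ioo a b, g (s, 1) = g (s, 0))
    {a' s : ℝ} (ha' : a < a') (hs : a' ≤ s) (hsb : s < b) (h0 : ∀ t, A (a', t) = 0) :
    ∫ t in (0 : ℝ)..1, A (s, t) ^ p ≤ (p * (p - 1) + p * κ) * 2 ^ (p / 2) *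
      ∫ z in Icc (a', (0 : ℝ)) (s, 1), (A z ^ p + m z ^ p + w z ^ p + x z ^ p) := by
  have hp0 : 0 < p := by linarith
  have hR : Icc (a', (0 : ℝ)) (s, 1) ⊆ Ioo a b ×ˢ univ := fun z hz ↦
    ⟨⟨ha'.trans_le hz.1.1, hz.2.1.trans_lt hsb⟩, trivial⟩
  have hAc : ContinuousOn A (Ioo a b ×ˢ univ) := by
    have : A = fun z ↦ √(A z ^ 2) := funext fun z ↦ (Real.sqrt_sq (hA0 z)).symm
    rw [this]
    exact hA.continuousOn.sqrt
  have hpow : ∀ {f : ℝ × ℝ → ℝ}, ContinuousOn f (Ioo a b ×ˢ univ) →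
      ContinuousOn (fun z ↦ f z ^ p) (Ioo a b ×ˢ univ) := fun hf ↦
    hf.rpow_const fun _ _ ↦ Or.inr hp0.le
  have hint : ∀ {f : ℝ × ℝ → ℝ}, ContinuousOn f (Ioo a b ×ˢ univ) →
      IntegrableOn f (Icc (a', (0 : ℝ)) (s, 1)) := fun hf ↦
    (hf.mono hR).integrableOn_compact isCompact_Icc
  have hline : ∀ {f : ℝ × ℝ → ℝ}, ContinuousOn f (Ioo a b ×ˢ univ) →
      Continuous fun t ↦ f (s, t) := fun hf ↦
    hf.comp_continuous (by fun_prop) fun t ↦ ⟨⟨ha'.trans_le hs, hsb⟩, trivial⟩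
  have hH : ContinuousOn (fun z ↦ A z ^ p + m z ^ p + w z ^ p + x z ^ p) (Ioo a b ×ˢ univ) :=
    (((hpow hAc).add (hpow hm)).add (hpow hw)).add (hpow hx)
  set C := p * (p - 1) + p * κ with hC
  have hC0 : 0 ≤ C := by
    have : 0 ≤ p - 1 := by linarith
    positivity
  set I := ∫ z in Icc (a', (0 : ℝ)) (s, 1), (A z ^ p + m z ^ p + w z ^ p + x z ^ p) with hI
  set V := volume.real (Icc (a', (0 : ℝ)) (s, 1)) with hV
  -- the estimate for the regularization `A ^ 2 + ε` of `A ^ 2`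
  have hreg : ∀ ε > 0, ∫ t in (0 : ℝ)..1, A (s, t) ^ p ≤
      C * 2 ^ (p / 2) * I + ε ^ (p / 2) * (1 + C * 2 ^ (p / 2) * V) := by
    intro ε hε
    have hr : ∀ z, 0 < A z ^ 2 + ε := fun z ↦ by positivity
    have hcr : ContinuousOn (fun z ↦ (A z ^ 2 + ε) ^ (p / 2)) (Ioo a b ×ˢ univ) :=
      (hA.continuousOn.add continuousOn_const).rpow_const fun z _ ↦ Or.inl (hr z).ne'
    -- Positivity of `A² + ε` is needed because the exponent `p/2 - 2` is negative for `p < 4`.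
    have hFle := integral_rpow_le_of_flux_le (p := p) (r := fun z ↦ A z ^ 2 + ε) (g := g)
      (H := fun z ↦ C * 2 ^ (p / 2) * (A z ^ p + m z ^ p + w z ^ p + x z ^ p)
            + C * 2 ^ (p / 2) * ε ^ (p / 2)) (hA.add contDiffOn_const) hg
      ((continuousOn_const.mul hH).add continuousOn_const) hr
      (fun s hs ↦ by simp only [hAp s hs]) hgp (fun z hzU ↦ ?_) ha' hs hsb
    -- The initial circle accounts for the summand `1` in the error factor; the summand with the
    -- area `V` comes from splitting `(A² + ε)^(p/2)` in `hadd`.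
    · have hzero : ∫ y in (0 : ℝ)..1, (A (a', y) ^ 2 + ε) ^ (p / 2) = ε ^ (p / 2) := by
        simp [h0]
      have hHi : IntegrableOn (fun z ↦ C * 2 ^ (p / 2) * (A z ^ p + m z ^ p + w z ^ p + x z ^ p))
          (Icc (a', (0 : ℝ)) (s, 1)) := hint (continuousOn_const.mul hH)
      rw [hzero, integral_add hHi (hint continuousOn_const), integral_const_mul,
        setIntegral_const, ← hI, ← hV, smul_eq_mul] at hFle
      have hmono : ∫ t in (0 : ℝ)..1, A (s, t) ^ p ≤
          ∫ t in (0 : ℝ)..1, (A (s, t) ^ 2 + ε) ^ (p / 2) := by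
        refine intervalIntegral.integral_mono_on zero_le_one
          ((hline (hpow hAc)).intervalIntegrable 0 1) ((hline hcr).intervalIntegrable 0 1)
          fun t _ ↦ ?_
        have hAA : (A (s, t) ^ 2) ^ (p / 2) = A (s, t) ^ p := by
          rw [← Real.rpow_two, ← Real.rpow_mul (hA0 _)]
          ring_nf
        rw [← hAA]
        gcongr
        linarith
      linarith
    · have hfd : fderiv ℝ (fun z ↦ A z ^ 2 + ε) z = fderiv ℝ (fun z ↦ A z ^ 2) z :=
        fderiv_add_const ε
      rw [hfd]
      have hsq : √(A z ^ 2 + ε) ^ 2 = A z ^ 2 + ε := Real.sq_sqrt (hr z).le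
      have hpw : ∀ r : ℝ, √(A z ^ 2 + ε) ^ r = (A z ^ 2 + ε) ^ (r / 2) := fun r ↦ by
        rw [Real.sqrt_eq_rpow, ← Real.rpow_mul (hr z).le]
        ring_nf
      have hfl := flux_bound hp hκ (Real.sqrt_pos.2 (hr z)) (hA0 z)
        (Real.le_sqrt_of_sq_le (by linarith)) (hm0 z) (hw0 z) (hx0 z) (hd z hzU) (hgw z hzU)
        (hAt z hzU)
      rw [hpw, hpw, hpw] at hfl
      have hle := (le_abs_self _).trans hfl
      have hadd := add_rpow_le (r := p / 2) (by linarith) (sq_nonneg (A z)) hε.le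
      have hAA : (A z ^ 2) ^ (p / 2) = A z ^ p := by
        rw [← Real.rpow_two, ← Real.rpow_mul (hA0 z)]
        ring_nf
      rw [hAA] at hadd
      have h2 : (1 : ℝ) ≤ 2 ^ (p / 2) := Real.one_le_rpow (by norm_num) (by linarith)
      have hmp := Real.rpow_nonneg (hm0 z) p
      have hwp := Real.rpow_nonneg (hw0 z) p
      have hxp := Real.rpow_nonneg (hx0 z) p
      have hsum : (A z ^ 2 + ε) ^ (p / 2) + m z ^ p + w z ^ p + x z ^ p ≤
          2 ^ (p / 2) * (A z ^ p + m z ^ p + w z ^ p + x z ^ p) + 2 ^ (p / 2) * ε ^ (p / 2) := by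
        nlinarith
      have hfin := hle.trans (mul_le_mul_of_nonneg_left hsum hC0)
      have e1 : (p - 2) / 2 = p / 2 - 1 := by ring
      have e2 : (p - 4) / 2 = p / 2 - 1 - 1 := by ring
      rw [e1, e2] at hfin
      linarith
  set B := 1 + C * 2 ^ (p / 2) * V with hB
  have hB0 : 0 < B := by
    have : 0 ≤ V := measureReal_nonneg
    positivity
  refine le_of_forall_pos_le_add fun δ hδ ↦ ?_
  -- This `ε` makes the error `ε^(p/2) * B` equal to `δ`.
  have h := hreg ((δ / B) ^ (2 / p)) (by positivity)
  rw [← Real.rpow_mul (by positivity), show 2 / p * (p / 2) = 1 by field_simp, Real.rpow_one,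
    div_mul_cancel₀ _ hB0.ne'] at h
  exact h

end Scalar

/-! ### Combining the trace and Sobolev bounds over the circles -/

section Product

/-- Dropping the null circle `s = b` leaves an open cylinder, where ordinary derivatives can be
used. -/
lemma volume_restrict_cylinder (a b : ℝ) :
    (volume.restrict (Ioc a b ×ˢ Ioc (0 : ℝ) 1) : Measure (ℝ × ℝ)) =
      (volume.restrict (Ioo a b)).prod (volume.restrict (Ioc (0 : ℝ) 1)) := by
  rw [Measure.volume_eq_prod, ← Measure.prod_restrict, restrict_Ioo_eq_restrict_Ioc]

lemma aemeasurable_of_continuousOn_cylinder {a b : ℝ} {f : ℝ × ℝ → ℝ}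
    (hf : ContinuousOn f (Ioo a b ×ˢ univ)) :
    AEMeasurable f ((volume.restrict (Ioo a b)).prod (volume.restrict (Ioc (0 : ℝ) 1))) := by
  rw [Measure.prod_restrict]
  exact (hf.mono (prod_mono_right (subset_univ _))).aemeasurable
    (measurableSet_Ioo.prod measurableSet_Ioc)

lemma continuous_line_of_continuousOn {a b s : ℝ} (hs : s ∈ Ioo a b) {f : ℝ × ℝ → ℝ}
    (hf : ContinuousOn f (Ioo a b ×ˢ univ)) : Continuous fun t ↦ f (s, t) :=
  hf.comp_continuous (by fun_prop) fun _ ↦ ⟨hs, trivial⟩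

lemma ofReal_intervalIntegral {f : ℝ → ℝ} (hf : Continuous f) (h0 : ∀ t, 0 ≤ f t) :
    ENNReal.ofReal (∫ t in (0 : ℝ)..1, f t) = ∫⁻ t in Ioc (0 : ℝ) 1, ENNReal.ofReal (f t) := by
  rw [intervalIntegral.integral_of_le zero_le_one]
  exact ofReal_integral_eq_lintegral_ofReal
    ((intervalIntegrable_iff_integrableOn_Ioc_of_le zero_le_one).1 (hf.intervalIntegrable 0 1))
    (Eventually.of_forall h0)

/-- A function on the cylinder is bounded by its `W^{1,p}` norm on circles. -/
lemma rpow_le_lintegral_circle {a b p s t : ℝ} (hp : 2 ≤ p) {Y n : ℝ × ℝ → ℝ}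
    (hY : ContDiffOn ℝ 1 (fun z ↦ Y z ^ 2) (Ioo a b ×ˢ univ))
    (hn : ContinuousOn n (Ioo a b ×ˢ univ)) (hY0 : ∀ z, 0 ≤ Y z) (hn0 : ∀ z, 0 ≤ n z)
    (hYt : ∀ z ∈ Ioo a b ×ˢ univ, |fderiv ℝ (fun z ↦ Y z ^ 2) z (0, 1)| ≤ 2 * Y z * n z)
    (hs : s ∈ Ioo a b) (ht : t ∈ Ioc (0 : ℝ) 1) :
    ENNReal.ofReal (Y (s, t) ^ p) ≤ ENNReal.ofReal (1 + p) *
      ∫⁻ t in Ioc (0 : ℝ) 1,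
        (ENNReal.ofReal (Y (s, t) ^ p) + ENNReal.ofReal (n (s, t) ^ p)) := by
  have hU : IsOpen (Ioo a b ×ˢ (univ : Set ℝ)) := isOpen_Ioo.prod isOpen_univ
  have hp0 : 0 ≤ p := by linarith
  have hYp : ∀ z (r : ℝ), (Y z ^ 2) ^ (r / 2) = Y z ^ r := fun z r ↦ by
    rw [← Real.rpow_two, ← Real.rpow_mul (hY0 z)]
    ring_nf
  have hY2 := continuous_line_of_continuousOn hs hY.continuousOn
  -- Only `Y²` is known to be `C¹`; as `p/2 ≥ 1`, the power `Y^p = (Y²)^(p/2)` is differentiable in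
  -- `t` even at zeros of `Y`.
  have hpY : Continuous fun t ↦ Y (s, t) ^ p := by
    have : (fun t ↦ Y (s, t) ^ p) = fun t ↦ (Y (s, t) ^ 2) ^ (p / 2) :=
      funext fun t ↦ (hYp _ _).symm
    rw [this]
    exact hY2.rpow_const fun _ ↦ Or.inr (by linarith)
  have hpn : Continuous fun t ↦ n (s, t) ^ p :=
    (continuous_line_of_continuousOn hs hn).rpow_const fun _ ↦ Or.inr hp0
  have hYd : ∀ t, HasDerivAt (fun t ↦ Y (s, t) ^ 2)
      (fderiv ℝ (fun z ↦ Y z ^ 2) (s, t) (0, 1)) t := fun t ↦ by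
    have h1 := ((hY.contDiffAt (hU.mem_nhds (x := (s, t)) ⟨hs, trivial⟩)).differentiableAt
      (by simp)).hasFDerivAt
    exact h1.comp_hasDerivAt t ((hasDerivAt_const t s).prodMk (hasDerivAt_id t))
  have hder : ∀ t, HasDerivAt (fun t ↦ Y (s, t) ^ p) (fderiv ℝ (fun z ↦ Y z ^ 2) (s, t) (0, 1)
      * (p / 2) * (Y (s, t) ^ 2) ^ (p / 2 - 1)) t := fun t ↦ by
    refine ((hYd t).rpow_const (p := p / 2) (Or.inr (by linarith))).congr_of_eventuallyEq ?_
    exact Eventually.of_forall fun t ↦ (hYp (s, t) p).symm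
  have hfd := continuous_line_of_continuousOn hs
    ((hY.continuousOn_fderiv_of_isOpen hU le_rfl).clm_apply
      (continuousOn_const (c := ((0 : ℝ), (1 : ℝ)))))
  have hcd : Continuous fun t ↦ fderiv ℝ (fun z ↦ Y z ^ 2) (s, t) (0, 1)
      * (p / 2) * (Y (s, t) ^ 2) ^ (p / 2 - 1) :=
    (hfd.mul continuous_const).mul (hY2.rpow_const fun _ ↦ Or.inr (by linarith))
  have hle : ∀ t, |fderiv ℝ (fun z ↦ Y z ^ 2) (s, t) (0, 1)
      * (p / 2) * (Y (s, t) ^ 2) ^ (p / 2 - 1)| ≤ p * (Y (s, t) ^ p + n (s, t) ^ p) := fun t ↦ by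
    have e1 : (Y (s, t) ^ 2) ^ (p / 2 - 1) = Y (s, t) ^ (p - 2) := by
      rw [← hYp, sub_div, div_self two_ne_zero]
    have e2 : Y (s, t) ^ (p - 2) * Y (s, t) = Y (s, t) ^ (p - 1) := by
      conv_lhs => rw [← Real.rpow_one (Y (s, t)), ← Real.rpow_mul (hY0 _),
        ← Real.rpow_add_of_nonneg (hY0 _) (by linarith) (by linarith)]
      ring_nf
    have hnn : 0 ≤ Y (s, t) ^ (p - 2) := Real.rpow_nonneg (hY0 _) _
    rw [e1, abs_mul, abs_mul, abs_of_nonneg (a := p / 2) (by linarith), abs_of_nonneg hnn]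
    calc _ ≤ 2 * Y (s, t) * n (s, t) * (p / 2) * Y (s, t) ^ (p - 2) := by
          gcongr
          exact hYt _ ⟨hs, trivial⟩
      _ = p * (Y (s, t) ^ (p - 1) * n (s, t)) := by rw [← e2]; ring
      _ ≤ _ := by
          gcongr
          exact rpow_sub_one_mul_le (by linarith) (hY0 _) (hn0 _)
  have hsum : Continuous fun t ↦ Y (s, t) ^ p + n (s, t) ^ p := hpY.add hpn
  have hpY0 : ∀ t, 0 ≤ Y (s, t) ^ p := fun t ↦ Real.rpow_nonneg (hY0 _) _
  have hpn0 : ∀ t, 0 ≤ n (s, t) ^ p := fun t ↦ Real.rpow_nonneg (hn0 _) _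
  have h1 := le_integral_add_of_hasDerivAt (fun t _ ↦ hder t) hcd.continuousOn
    (continuous_const.mul hsum).continuousOn (fun t _ ↦ hle t)
    (Ioc_subset_Icc_self ht)
  have h2 : ∫ t in (0 : ℝ)..1, (Y (s, t) ^ p + p * (Y (s, t) ^ p + n (s, t) ^ p)) ≤
      (1 + p) * ∫ t in (0 : ℝ)..1, (Y (s, t) ^ p + n (s, t) ^ p) := by
    rw [← intervalIntegral.integral_const_mul]
    refine intervalIntegral.integral_mono_on zero_le_one
      ((hpY.add (continuous_const.mul hsum)).intervalIntegrable 0 1)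
      ((continuous_const.mul hsum).intervalIntegrable 0 1) fun t _ ↦ ?_
    linarith [hpn0 t]
  refine (ENNReal.ofReal_le_ofReal (h1.trans h2)).trans (le_of_eq ?_)
  rw [ENNReal.ofReal_mul (by linarith), ofReal_intervalIntegral hsum
    fun t ↦ add_nonneg (hpY0 t) (hpn0 t)]
  simp_rw [ENNReal.ofReal_add (hpY0 _) (hpn0 _)]

/-- The product estimate for scalar functions on the cylinder. -/
lemma lintegral_mul_rpow_le {a b p κ : ℝ} (hp : 2 ≤ p) (hκ : 0 ≤ κ) {A g m w x Y n : ℝ × ℝ → ℝ}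
    (hA : ContDiffOn ℝ 1 (fun z ↦ A z ^ 2) (Ioo a b ×ˢ univ))
    (hg : ContDiffOn ℝ 1 g (Ioo a b ×ˢ univ))
    (hm : ContinuousOn m (Ioo a b ×ˢ univ)) (hw : ContinuousOn w (Ioo a b ×ˢ univ))
    (hx : ContinuousOn x (Ioo a b ×ˢ univ))
    (hA0 : ∀ z, 0 ≤ A z) (hm0 : ∀ z, 0 ≤ m z) (hw0 : ∀ z, 0 ≤ w z) (hx0 : ∀ z, 0 ≤ x z)
    (hAt : ∀ z ∈ Ioo a b ×ˢ univ, |fderiv ℝ (fun z ↦ A z ^ 2) z (0, 1)| ≤ 2 * A z * m z)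
    (hgw : ∀ z ∈ Ioo a b ×ˢ univ, |g z| ≤ A z * w z)
    (hd : ∀ z ∈ Ioo a b ×ˢ univ,
      |1 / 2 * fderiv ℝ (fun z ↦ A z ^ 2) z (1, 0) - fderiv ℝ g z (0, 1)| ≤
        m z * w z + κ * A z * x z)
    (hAp : ∀ s ∈ Ioo a b, A (s, 1) = A (s, 0)) (hgp : ∀ s ∈ Ioo a b, g (s, 1) = g (s, 0))
    {a' : ℝ} (ha' : a < a') (h0 : ∀ s ∈ Ioo a b, s ≤ a' → ∀ t, A (s, t) = 0)
    (hY : ContDiffOn ℝ 1 (fun z ↦ Y z ^ 2) (Ioo a b ×ˢ univ))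
    (hn : ContinuousOn n (Ioo a b ×ˢ univ)) (hY0 : ∀ z, 0 ≤ Y z) (hn0 : ∀ z, 0 ≤ n z)
    (hYt : ∀ z ∈ Ioo a b ×ˢ univ, |fderiv ℝ (fun z ↦ Y z ^ 2) z (0, 1)| ≤ 2 * Y z * n z) :
    ∫⁻ z in Ioc a b ×ˢ Ioc (0 : ℝ) 1, ENNReal.ofReal ((A z * Y z) ^ p) ≤
      ENNReal.ofReal ((p * (p - 1) + p * κ) * 2 ^ (p / 2)) *
      (∫⁻ z in Ioc a b ×ˢ Ioc (0 : ℝ) 1, (ENNReal.ofReal (x z ^ p) + ENNReal.ofReal (w z ^ p)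
        + ENNReal.ofReal (A z ^ p) + ENNReal.ofReal (m z ^ p))) *
      (ENNReal.ofReal (1 + p) *
        ∫⁻ z in Ioc a b ×ˢ Ioc (0 : ℝ) 1, (ENNReal.ofReal (Y z ^ p) + ENNReal.ofReal (n z ^ p))) := by
  have hp0 : 0 < p := by linarith
  have hsqrt : ∀ {f : ℝ × ℝ → ℝ}, (∀ z, 0 ≤ f z) →
      ContDiffOn ℝ 1 (fun z ↦ f z ^ 2) (Ioo a b ×ˢ univ) → ContinuousOn f (Ioo a b ×ˢ univ) := by
    intro f hf0 hf
    have : f = fun z ↦ √(f z ^ 2) := funext fun z ↦ (Real.sqrt_sq (hf0 z)).symm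
    rw [this]
    exact hf.continuousOn.sqrt
  have hpow : ∀ {f : ℝ × ℝ → ℝ}, ContinuousOn f (Ioo a b ×ˢ univ) →
      ContinuousOn (fun z ↦ f z ^ p) (Ioo a b ×ˢ univ) := fun hf ↦
    hf.rpow_const fun _ _ ↦ Or.inr hp0.le
  have hAc := hsqrt hA0 hA
  have hYc := hsqrt hY0 hY
  have hnn : ∀ {f : ℝ × ℝ → ℝ}, (∀ z, 0 ≤ f z) → ∀ z, 0 ≤ f z ^ p := fun hf z ↦
    Real.rpow_nonneg (hf z) p
  have hC0 : 0 ≤ (p * (p - 1) + p * κ) * 2 ^ (p / 2) := by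
    have : 0 ≤ p - 1 := by linarith
    positivity
  have hmeas : ∀ {f : ℝ × ℝ → ℝ}, ContinuousOn f (Ioo a b ×ˢ univ) →
      AEMeasurable (fun z ↦ ENNReal.ofReal (f z ^ p))
        ((volume.restrict (Ioo a b)).prod (volume.restrict (Ioc (0 : ℝ) 1))) := fun hf ↦
    (aemeasurable_of_continuousOn_cylinder (hpow hf)).ennreal_ofReal
  set J := ∫⁻ z in Ioc a b ×ˢ Ioc (0 : ℝ) 1, (ENNReal.ofReal (x z ^ p) + ENNReal.ofReal (w z ^ p)
        + ENNReal.ofReal (A z ^ p) + ENNReal.ofReal (m z ^ p)) with hJ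
  set T := ENNReal.ofReal ((p * (p - 1) + p * κ) * 2 ^ (p / 2)) * J with hT
  -- the trace estimate on each circle
  have htrace : ∀ s ∈ Ioo a b, ∫⁻ t in Ioc (0 : ℝ) 1, ENNReal.ofReal (A (s, t) ^ p) ≤ T := by
    intro s hs
    -- Circles with `s ≤ a'` lie where `A` vanishes; the others start the trace estimate from the
    -- circle at `a'`.
    rcases le_or_gt s a' with hsa | hsa
    · simp [h0 s hs hsa, Real.zero_rpow hp0.ne']
    have h := trace_estimate hp hκ hA hg hm hw hx hA0 hm0 hw0 hx0 hAt hgw hd hAp hgp ha' hsa.le hs.2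
      (h0 a' ⟨ha', hsa.trans hs.2⟩ le_rfl)
    have hR : Icc (a', (0 : ℝ)) (s, 1) ⊆ Ioo a b ×ˢ univ := fun z hz ↦
      ⟨⟨ha'.trans_le hz.1.1, hz.2.1.trans_lt hs.2⟩, trivial⟩
    have hint : IntegrableOn (fun z ↦ A z ^ p + m z ^ p + w z ^ p + x z ^ p)
        (Icc (a', (0 : ℝ)) (s, 1)) :=
      (((((hpow hAc).add (hpow hm)).add (hpow hw)).add (hpow hx)).mono hR).integrableOn_compact
        isCompact_Icc
    rw [← ofReal_intervalIntegral (continuous_line_of_continuousOn hs (hpow hAc))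
      fun t ↦ hnn hA0 _]
    refine (ENNReal.ofReal_le_ofReal h).trans ?_
    rw [ENNReal.ofReal_mul hC0, hT]
    gcongr
    rw [ofReal_integral_eq_lintegral_ofReal hint (Eventually.of_forall fun z ↦
      add_nonneg (add_nonneg (add_nonneg (hnn hA0 z) (hnn hm0 z)) (hnn hw0 z)) (hnn hx0 z)),
      hJ, ← Icc_prod_Icc, Measure.volume_eq_prod, ← Measure.prod_restrict,
      ← restrict_Ioc_eq_restrict_Icc (a := (0 : ℝ)), Measure.prod_restrict]
    have hsub : Icc a' s ×ˢ Ioc (0 : ℝ) 1 ⊆ Ioc a b ×ˢ Ioc (0 : ℝ) 1 := fun z hz ↦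
      ⟨⟨ha'.trans_le hz.1.1, hz.1.2.trans hs.2.le⟩, hz.2⟩
    refine (lintegral_mono_set hsub).trans (lintegral_mono fun z ↦ le_of_eq ?_)
    rw [← ENNReal.ofReal_add (hnn hx0 z) (hnn hw0 z), ← ENNReal.ofReal_add
      (add_nonneg (hnn hx0 z) (hnn hw0 z)) (hnn hA0 z), ← ENNReal.ofReal_add
      (add_nonneg (add_nonneg (hnn hx0 z) (hnn hw0 z)) (hnn hA0 z)) (hnn hm0 z)]
    congr 1
    ring
  have hmAY : AEMeasurable (fun z ↦ ENNReal.ofReal ((A z * Y z) ^ p))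
      ((volume.restrict (Ioo a b)).prod (volume.restrict (Ioc (0 : ℝ) 1))) :=
    hmeas (f := fun z ↦ A z * Y z) (hAc.mul hYc)
  have hmYn : AEMeasurable (fun z ↦ ENNReal.ofReal (Y z ^ p) + ENNReal.ofReal (n z ^ p))
      ((volume.restrict (Ioo a b)).prod (volume.restrict (Ioc (0 : ℝ) 1))) :=
    (hmeas hYc).add (hmeas hn)
  rw [volume_restrict_cylinder, lintegral_prod _ hmAY, lintegral_prod _ hmYn,
    ← lintegral_const_mul'' _ hmYn.lintegral_prod_right', ← lintegral_const_mul'' _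
      (hmYn.lintegral_prod_right'.const_mul _)]
  refine lintegral_mono_ae ?_
  filter_upwards [ae_restrict_mem measurableSet_Ioo] with s hs
  -- On one circle `Y^p` is replaced by a bound independent of `t`; the remaining integral of `A^p`
  -- is at most `T`, independently of `s`.
  calc ∫⁻ t in Ioc (0 : ℝ) 1, ENNReal.ofReal ((A (s, t) * Y (s, t)) ^ p)
      ≤ ∫⁻ t in Ioc (0 : ℝ) 1, ENNReal.ofReal (A (s, t) ^ p) * (ENNReal.ofReal (1 + p) *
          ∫⁻ t in Ioc (0 : ℝ) 1,
            (ENNReal.ofReal (Y (s, t) ^ p) + ENNReal.ofReal (n (s, t) ^ p))) := by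
        refine lintegral_mono_ae ?_
        filter_upwards [ae_restrict_mem measurableSet_Ioc] with t ht
        rw [Real.mul_rpow (hA0 _) (hY0 _), ENNReal.ofReal_mul (hnn hA0 _)]
        gcongr
        exact rpow_le_lintegral_circle hp hY hn hY0 hn0 hYt hs ht
    _ = (∫⁻ t in Ioc (0 : ℝ) 1, ENNReal.ofReal (A (s, t) ^ p)) * (ENNReal.ofReal (1 + p) *
          ∫⁻ t in Ioc (0 : ℝ) 1,
            (ENNReal.ofReal (Y (s, t) ^ p) + ENNReal.ofReal (n (s, t) ^ p))) :=
        lintegral_mul_const'' _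
          (continuous_line_of_continuousOn hs (hpow hAc)).measurable.ennreal_ofReal.aemeasurable
    _ ≤ _ := by
        gcongr
        exact htrace s hs

end Product

/-! ### Vector fields along a map of the cylinder -/

section CylinderFields

lemma strip_mem_nhds {a b : ℝ} {z : ℝ × ℝ} (hz : z ∈ Ioo a b ×ˢ (univ : Set ℝ)) :
    strip a b ∈ 𝓝 z :=
  mem_of_superset ((isOpen_Ioo.prod isOpen_univ).mem_nhds hz)
    (prod_mono Ioo_subset_Ioc_self subset_rfl)

lemma lpNorm_rpow {a b p : ℝ} (hp : 0 < p) {f : ℝ × ℝ → ℝ} (hf : ∀ z, 0 ≤ f z) :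
    lpNorm a b p f ^ p = ∫⁻ z in Ioc a b ×ˢ Ioc (0 : ℝ) 1, ENNReal.ofReal (f z ^ p) := by
  rw [lpNorm, eLpNorm_eq_lintegral_rpow_enorm_toReal (by simpa using hp) ENNReal.ofReal_ne_top,
    ENNReal.toReal_ofReal hp.le, ← ENNReal.rpow_mul, one_div_mul_cancel hp.ne', ENNReal.rpow_one]
  refine lintegral_congr fun z ↦ ?_
  rw [Real.enorm_of_nonneg (hf z), ENNReal.ofReal_rpow_of_nonneg (hf z) hp.le]

variable {E : Type*} [NormedAddCommGroup E] [NormedSpace ℝ E]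
  {N : Type*} [TopologicalSpace N] [ChartedSpace E N] [IsManifold 𝓘(ℝ, E) ∞ N]
  {a b : ℝ} {u : ℝ × ℝ → N} {ξ η : ∀ z, TangentSpace 𝓘(ℝ, E) (u z)}

lemma IsSmoothCompactField.smoothFieldAt (hξ : IsSmoothCompactField a b u ξ) :
    ∀ z ∈ Ioo a b ×ˢ (univ : Set ℝ), SmoothFieldAt u ξ z := fun _ hz ↦
  hξ.smooth.contMDiffAt (strip_mem_nhds hz)

lemma IsSmoothCompactField.exists_eq_zero (hab : a < b) (hξ : IsSmoothCompactField a b u ξ) :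
    ∃ k, a < k ∧ ∀ s ∈ Ioc a b, s < k → ∀ t, ξ (s, t) = 0 := by
  obtain ⟨K, hK, hKab, h0⟩ := hξ.compactSupport
  rcases K.eq_empty_or_nonempty with rfl | hne
  · exact ⟨b, hab, fun s hs _ ↦ h0 s hs (notMem_empty s)⟩
  · refine ⟨sInf K, (hKab (hK.sInf_mem hne)).1, fun s hs hsk ↦ h0 s hs fun hsK ↦ ?_⟩
    exact absurd (csInf_le hK.bddBelow hsK) (not_le.2 hsk)

variable [RiemannianBundle (fun q : N ↦ TangentSpace 𝓘(ℝ, E) q)]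

-- Values of a field at `(s, t)` and `(s, t + 1)` have different types, so periodicity is stated in
-- the tangent bundle; this extracts the equality of inner products.
omit [IsManifold 𝓘(ℝ, E) ∞ N] in
lemma inner_eq_of_mk_eq {x y : N} {v w : TangentSpace 𝓘(ℝ, E) x} {v' w' : TangentSpace 𝓘(ℝ, E) y}
    (h : (⟨x, v⟩ : TangentBundle 𝓘(ℝ, E) N) = ⟨y, v'⟩)
    (h' : (⟨x, w⟩ : TangentBundle 𝓘(ℝ, E) N) = ⟨y, w'⟩) : inner ℝ v w = inner ℝ v' w' := by
  cases h
  cases h'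
  rfl

lemma covDeriv_eq_zero {S : Set (ℝ × ℝ)} {z : ℝ × ℝ} (hS : S ∈ 𝓝 z) (hξ : SmoothFieldAt u ξ z)
    (h0 : ∀ᶠ z' in 𝓝 z, ξ z' = 0) (e : ℝ × ℝ) : covDeriv S u e ξ z = 0 := by
  have h : fieldCoord (u z) u ξ =ᶠ[𝓝 z] fun _ ↦ 0 := h0.mono fun z' hz' ↦ by
    rw [fieldCoord, hz', map_zero]
  have h' : localCovDeriv (chartMetric (u z)) (mapCoord (u z) u) (fun _ ↦ (0 : E)) e z = 0 := by
    simp [localCovDeriv]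
  rw [covDeriv_eq hS hξ, localCovDeriv_congr h, h']
  exact map_zero (fromChart (u z) (extChartAt 𝓘(ℝ, E) (u z) (u z)))

/-- The covariant derivative of a periodic field is periodic. -/
lemma covDeriv_periodic (hu : ∀ s ∈ Ioc a b, ∀ t : ℝ, u (s, t + 1) = u (s, t))
    (hξs : ∀ z ∈ Ioo a b ×ˢ (univ : Set ℝ), SmoothFieldAt u ξ z)
    (hξ : ∀ s ∈ Ioo a b, ∀ t : ℝ,
      (⟨u (s, t + 1), ξ (s, t + 1)⟩ : TangentBundle 𝓘(ℝ, E) N) = ⟨u (s, t), ξ (s, t)⟩)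
    (e : ℝ × ℝ) : ∀ s ∈ Ioo a b, ∀ t : ℝ,
      (⟨u (s, t + 1), covDeriv (strip a b) u e ξ (s, t + 1)⟩ : TangentBundle 𝓘(ℝ, E) N) =
        ⟨u (s, t), covDeriv (strip a b) u e ξ (s, t)⟩ := by
  intro s hs t
  have hz : ∀ t : ℝ, (s, t) ∈ Ioo a b ×ˢ (univ : Set ℝ) := fun t ↦ ⟨hs, trivial⟩
  have hshift : ∀ {F : ℝ × ℝ → E}, (∀ s ∈ Ioo a b, ∀ t : ℝ, F (s, t + 1) = F (s, t)) →
      fderiv ℝ F (s, t + 1) = fderiv ℝ F (s, t) := by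
    intro F hF
    have h1 := fderiv_comp_add_right (𝕜 := ℝ) (f := F) (x := (s, t)) ((0 : ℝ), (1 : ℝ))
    have h2 : (fun z ↦ F (z + (0, 1))) =ᶠ[𝓝 (s, t)] F := by
      filter_upwards [(isOpen_Ioo.prod isOpen_univ).mem_nhds (hz t)] with z hz'
      have h3 : z + (0, 1) = (z.1, z.2 + 1) := by ext <;> simp
      rw [h3]
      exact hF z.1 hz'.1 z.2
    rw [h2.fderiv_eq] at h1
    rw [h1]
    simp
  -- Separating the chart centre `x` from the point `w` allows `u (s, t + 1)` to be rewritten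
  -- without dependent-type obstructions; in a fixed chart the coordinates are periodic functions.
  let G : N → ℝ × ℝ → TangentBundle 𝓘(ℝ, E) N := fun x w ↦ ⟨x, (fromChart x
    (extChartAt 𝓘(ℝ, E) x x)
    (localCovDeriv (chartMetric x) (mapCoord x u) (fieldCoord x u ξ) e w) : E)⟩
  have hG : ∀ t, (⟨u (s, t), covDeriv (strip a b) u e ξ (s, t)⟩ : TangentBundle 𝓘(ℝ, E) N) =
      G (u (s, t)) (s, t) := fun t ↦ by
    rw [covDeriv_eq (strip_mem_nhds (hz t)) (hξs _ (hz t))]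
  have hc : ∀ x, ∀ s ∈ Ioo a b, ∀ t : ℝ,
      mapCoord (E := E) x u (s, t + 1) = mapCoord x u (s, t) := fun x s hs t ↦ by
    rw [mapCoord, hu s (Ioo_subset_Ioc_self hs) t]
  have hv : ∀ x, ∀ s ∈ Ioo a b, ∀ t : ℝ,
      fieldCoord x u ξ (s, t + 1) = fieldCoord x u ξ (s, t) := fun x s hs t ↦
    congrArg (fun q : TangentBundle 𝓘(ℝ, E) N ↦ (toChart x q.1 q.2 : E)) (hξ s hs t)
  rw [hG, hG, hu s (Ioo_subset_Ioc_self hs) t]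
  have hloc : ∀ x, localCovDeriv (chartMetric x) (mapCoord x u) (fieldCoord x u ξ) e (s, t + 1) =
      localCovDeriv (chartMetric x) (mapCoord x u) (fieldCoord x u ξ) e (s, t) := fun x ↦ by
    rw [localCovDeriv, localCovDeriv, hshift (hc x), hshift (hv x), hc x s hs, hv x s hs]
  simp only [G, hloc]

omit [IsManifold 𝓘(ℝ, E) ∞ N] in
lemma norm_le_of_supNorm_le {c : ℝ} (hc : 0 ≤ c) (h : supNorm a b u ξ ≤ ENNReal.ofReal c)
    {z : ℝ × ℝ} (hz : z ∈ strip a b) : ‖ξ z‖ ≤ c := by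
  have h1 : ‖ξ z‖ₑ ≤ ENNReal.ofReal c :=
    (le_iSup₂_of_le (f := fun z _ ↦ ‖ξ z‖ₑ) z hz le_rfl).trans h
  rwa [← ofReal_norm, ENNReal.ofReal_le_ofReal_iff hc] at h1

variable [FiniteDimensional ℝ E]
  [IsContMDiffRiemannianBundle 𝓘(ℝ, E) ∞ E (fun q : N ↦ TangentSpace 𝓘(ℝ, E) q)]

omit [FiniteDimensional ℝ E] in
lemma contDiffOn_inner_field {U : Set (ℝ × ℝ)} (hξ : ∀ z ∈ U, SmoothFieldAt u ξ z)
    (hη : ∀ z ∈ U, SmoothFieldAt u η z) : ContDiffOn ℝ 1 (fun z ↦ inner ℝ (ξ z) (η z)) U :=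
  fun z hz ↦ (((hξ z hz).contDiffAt_inner (hη z hz)).of_le (by norm_cast)).contDiffWithinAt

omit [FiniteDimensional ℝ E] in
lemma contDiffOn_norm_sq_field {U : Set (ℝ × ℝ)} (hξ : ∀ z ∈ U, SmoothFieldAt u ξ z) :
    ContDiffOn ℝ 1 (fun z ↦ ‖ξ z‖ ^ 2) U := by
  simp_rw [← real_inner_self_eq_norm_sq]
  exact contDiffOn_inner_field hξ hξ

omit [FiniteDimensional ℝ E] in
lemma continuousOn_norm_field {U : Set (ℝ × ℝ)} (hξ : ∀ z ∈ U, SmoothFieldAt u ξ z) :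
    ContinuousOn (fun z ↦ ‖ξ z‖) U := by
  have h := (contDiffOn_norm_sq_field hξ).continuousOn.sqrt
  simpa only [Real.sqrt_sq (norm_nonneg _)] using h

lemma fderiv_norm_sq_field {S : Set (ℝ × ℝ)} {z : ℝ × ℝ} (hS : S ∈ 𝓝 z)
    (hξ : SmoothFieldAt u ξ z) (e : ℝ × ℝ) :
    fderiv ℝ (fun z ↦ ‖ξ z‖ ^ 2) z e = 2 * inner ℝ (ξ z) (covDeriv S u e ξ z) := by
  simp_rw [← real_inner_self_eq_norm_sq]
  rw [fderiv_inner_field hS hξ hξ, real_inner_comm]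
  ring

lemma abs_fderiv_norm_sq_field_le {S : Set (ℝ × ℝ)} {z : ℝ × ℝ} (hS : S ∈ 𝓝 z)
    (hξ : SmoothFieldAt u ξ z) (e : ℝ × ℝ) :
    |fderiv ℝ (fun z ↦ ‖ξ z‖ ^ 2) z e| ≤ 2 * ‖ξ z‖ * ‖covDeriv S u e ξ z‖ := by
  rw [fderiv_norm_sq_field hS hξ, abs_mul, abs_two, mul_assoc]
  gcongr
  exact abs_real_inner_le_norm _ _

/-- The `s`-derivative of `‖∇_t ξ‖ ^ 2 / 2` is the `t`-derivative of `⟪∇_t ξ, ∇_s ξ⟫` up to lower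
order terms. -/
lemma abs_half_fderiv_sub_le {K : ℝ≥0} (hK : curvatureSupNorm E N ≤ K) {c : ℝ} (hc : 0 ≤ c)
    {z : ℝ × ℝ} (hz : z ∈ Ioo a b ×ˢ (univ : Set ℝ))
    (hs : ‖mapDeriv (E := E) (strip a b) u (1, 0) z‖ ≤ c)
    (ht : ‖mapDeriv (E := E) (strip a b) u (0, 1) z‖ ≤ c)
    (hξ : ∀ z ∈ Ioo a b ×ˢ (univ : Set ℝ), SmoothFieldAt u ξ z) :
    |1 / 2 * fderiv ℝ (fun z ↦ ‖covDerivT a b u ξ z‖ ^ 2) z (1, 0)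
        - fderiv ℝ (fun z ↦ inner ℝ (covDerivT a b u ξ z) (covDerivS a b u ξ z)) z (0, 1)| ≤
      ‖covDerivT a b u (covDerivT a b u ξ) z‖ * ‖covDerivS a b u ξ z‖
        + K * c * c * ‖covDerivT a b u ξ z‖ * ‖ξ z‖ := by
  have hU : IsOpen (Ioo a b ×ˢ (univ : Set ℝ)) := isOpen_Ioo.prod isOpen_univ
  have hUS : Ioo a b ×ˢ (univ : Set ℝ) ⊆ strip a b := prod_mono Ioo_subset_Ioc_self subset_rfl
  have hS := strip_mem_nhds hz
  have hη := smoothFieldAt_covDeriv hU hUS hξ (0, 1)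
  have hζ := smoothFieldAt_covDeriv hU hUS hξ (1, 0)
  have hcomm := covDeriv_comm hU hUS hξ hz (1, 0) (0, 1)
  have h1 : fderiv ℝ (fun z ↦ ‖covDerivT a b u ξ z‖ ^ 2) z (1, 0) = _ :=
    fderiv_norm_sq_field hS (hη z hz) (1, 0)
  have h2 : fderiv ℝ (fun z ↦ inner ℝ (covDerivT a b u ξ z) (covDerivS a b u ξ z)) z (0, 1) = _ :=
    fderiv_inner_field hS (hη z hz) (hζ z hz) (0, 1)
  rw [h1, h2, hcomm, inner_add_right]
  set R := curvature (u z) (mapDeriv (strip a b) u (1, 0) z) (mapDeriv (strip a b) u (0, 1) z) (ξ z)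
  have hR : ‖R‖ ≤ K * c * c * ‖ξ z‖ := (norm_curvature_le hK _ _ _ _).trans (by gcongr)
  -- Here `x = ⟨∇_t ξ, ∇_t ∇_s ξ⟩` cancels; `⟨∇_t ∇_t ξ, ∇_s ξ⟩` and the curvature term remain.
  have e : ∀ x y w : ℝ, 1 / 2 * (2 * (x + y)) - (w + x) = -w + y := fun x y w ↦ by ring
  rw [e]
  refine (abs_add_le _ _).trans (add_le_add ?_ ?_)
  · rw [abs_neg]
    exact abs_real_inner_le_norm _ _
  · refine (abs_real_inner_le_norm _ _).trans ?_
    calc _ ≤ ‖covDerivT a b u ξ z‖ * (K * c * c * ‖ξ z‖) := by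
          gcongr
          exact le_rfl
      _ = _ := by ring

end CylinderFields

/-! ### The product estimate for covariant derivatives -/

section ProductEstimate

variable {E : Type*} [NormedAddCommGroup E] [NormedSpace ℝ E]
  {N : Type*} [TopologicalSpace N] [ChartedSpace E N] [IsManifold 𝓘(ℝ, E) ∞ N]
  [RiemannianBundle (fun q : N ↦ TangentSpace 𝓘(ℝ, E) q)]
  {a b : ℝ} {u : ℝ × ℝ → N} {ξ X : ∀ z, TangentSpace 𝓘(ℝ, E) (u z)}
  [FiniteDimensional ℝ E]
  [IsContMDiffRiemannianBundle 𝓘(ℝ, E) ∞ E (fun q : N ↦ TangentSpace 𝓘(ℝ, E) q)]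

lemma lintegral_covDeriv_mul_rpow_le {p : ℝ} (hp : 2 ≤ p) {K : ℝ≥0}
    (hK : curvatureSupNorm E N ≤ K) {c : ℝ} (hc : 0 ≤ c) (hab : a < b) (hu : IsSmoothMap E a b u)
    (hs : supNorm a b u (mapDeriv (E := E) (strip a b) u (1, 0)) ≤ ENNReal.ofReal c)
    (ht : supNorm a b u (mapDeriv (E := E) (strip a b) u (0, 1)) ≤ ENNReal.ofReal c)
    (hξ : IsSmoothCompactField a b u ξ) (hX : IsSmoothCompactField a b u X) :
    ∫⁻ z in Ioc a b ×ˢ Ioc (0 : ℝ) 1,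
        ENNReal.ofReal ((‖covDerivT a b u ξ z‖ * ‖covDerivT a b u X z‖) ^ p) ≤
      ENNReal.ofReal ((p * (p - 1) + p * (K * c * c)) * 2 ^ (p / 2)) *
      (∫⁻ z in Ioc a b ×ˢ Ioc (0 : ℝ) 1, (ENNReal.ofReal (‖ξ z‖ ^ p)
        + ENNReal.ofReal (‖covDerivS a b u ξ z‖ ^ p) + ENNReal.ofReal (‖covDerivT a b u ξ z‖ ^ p)
        + ENNReal.ofReal (‖covDerivT a b u (covDerivT a b u ξ) z‖ ^ p))) *
      (ENNReal.ofReal (1 + p) * ∫⁻ z in Ioc a b ×ˢ Ioc (0 : ℝ) 1,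
        (ENNReal.ofReal (‖covDerivT a b u X z‖ ^ p)
          + ENNReal.ofReal (‖covDerivT a b u (covDerivT a b u X) z‖ ^ p))) := by
  have hU : IsOpen (Ioo a b ×ˢ (univ : Set ℝ)) := isOpen_Ioo.prod isOpen_univ
  have hUS : Ioo a b ×ˢ (univ : Set ℝ) ⊆ strip a b := prod_mono Ioo_subset_Ioc_self subset_rfl
  have hξs := hξ.smoothFieldAt
  have hη := smoothFieldAt_covDeriv hU hUS hξs (0, 1)
  have hζ := smoothFieldAt_covDeriv hU hUS hξs (1, 0)
  have hη' := smoothFieldAt_covDeriv hU hUS hη (0, 1)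
  have hY := smoothFieldAt_covDeriv hU hUS hX.smoothFieldAt (0, 1)
  have hY' := smoothFieldAt_covDeriv hU hUS hY (0, 1)
  obtain ⟨k, hk, h0⟩ := hξ.exists_eq_zero hab
  have hper := covDeriv_periodic hu.periodic hξs
    fun s hs t ↦ hξ.periodic s (Ioo_subset_Ioc_self hs) t
  have hinner : ∀ e e' s, s ∈ Ioo a b →
      inner ℝ (covDeriv (strip a b) u e ξ (s, 1)) (covDeriv (strip a b) u e' ξ (s, 1)) =
      inner ℝ (covDeriv (strip a b) u e ξ (s, 0)) (covDeriv (strip a b) u e' ξ (s, 0)) := by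
    intro e e' s hs
    have h1 := inner_eq_of_mk_eq (hper e s hs 0) (hper e' s hs 0)
    rwa [zero_add] at h1
  refine lintegral_mul_rpow_le (g := fun z ↦ inner ℝ (covDerivT a b u ξ z) (covDerivS a b u ξ z))
    -- The midpoint lies strictly between `a` and `k`, so for `s ≤ a'` the field `ξ` vanishes in a
    -- neighbourhood and hence so does `∇_t ξ`.
    (κ := K * c * c) (a' := (a + k) / 2) hp (by positivity) (contDiffOn_norm_sq_field hη)
    (contDiffOn_inner_field hη hζ) (continuousOn_norm_field hη') (continuousOn_norm_field hζ)
    (continuousOn_norm_field hξs) (fun _ ↦ norm_nonneg _) (fun _ ↦ norm_nonneg _)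
    (fun _ ↦ norm_nonneg _) (fun _ ↦ norm_nonneg _)
    (fun z hz ↦ abs_fderiv_norm_sq_field_le (strip_mem_nhds hz) (hη z hz) (0, 1))
    (fun z _ ↦ abs_real_inner_le_norm _ _)
    (fun z hz ↦ abs_half_fderiv_sub_le hK hc hz (norm_le_of_supNorm_le hc hs (hUS hz))
      (norm_le_of_supNorm_le hc ht (hUS hz)) hξs)
    (fun s hs ↦ ?_) (fun s hs ↦ hinner _ _ s hs) (by linarith) (fun s hs hsk t ↦ ?_)
    (contDiffOn_norm_sq_field hY) (continuousOn_norm_field hY') (fun _ ↦ norm_nonneg _)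
    (fun _ ↦ norm_nonneg _)
    (fun z hz ↦ abs_fderiv_norm_sq_field_le (strip_mem_nhds hz) (hY z hz) (0, 1))
  · have h := hinner (0, 1) (0, 1) s hs
    rw [real_inner_self_eq_norm_sq, real_inner_self_eq_norm_sq] at h
    exact (sq_eq_sq₀ (norm_nonneg _) (norm_nonneg _)).1 h
  · have hz : (s, t) ∈ Ioo a b ×ˢ (univ : Set ℝ) := ⟨hs, trivial⟩
    refine norm_eq_zero.2 (covDeriv_eq_zero (strip_mem_nhds hz) (hξs _ hz) ?_ _)
    have hsk' : s < k := by linarith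
    filter_upwards [((isOpen_Ioo.inter isOpen_Iio).prod isOpen_univ).mem_nhds
      (show (s, t) ∈ (Ioo a b ∩ Iio k) ×ˢ (univ : Set ℝ) from ⟨⟨hs, hsk'⟩, trivial⟩)] with z hz'
    exact h0 z.1 (Ioo_subset_Ioc_self hz'.1.1) hz'.1.2 z.2

lemma lpNorm_covDeriv_mul_le {p : ℝ} (hp : 2 ≤ p) {K : ℝ≥0}
    (hK : curvatureSupNorm E N ≤ K) {c : ℝ} (hc : 0 ≤ c) (hab : a < b) (hu : IsSmoothMap E a b u)
    (hs : supNorm a b u (mapDeriv (E := E) (strip a b) u (1, 0)) ≤ ENNReal.ofReal c)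
    (ht : supNorm a b u (mapDeriv (E := E) (strip a b) u (0, 1)) ≤ ENNReal.ofReal c)
    (hξ : IsSmoothCompactField a b u ξ) (hX : IsSmoothCompactField a b u X) :
    lpNorm a b p (fun z ↦ ‖covDerivT a b u ξ z‖ * ‖covDerivT a b u X z‖) ≤
      ENNReal.ofReal (((p * (p - 1) + p * (K * c * c)) * 2 ^ (p / 2) * (1 + p)) ^ (1 / p)) *
        parabolicNorm a b p u ξ *
        (fieldLpNorm a b p u (covDerivT a b u X)
          + fieldLpNorm a b p u (covDerivT a b u (covDerivT a b u X))) := by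
  have hp0 : 0 < p := by linarith
  have hU : IsOpen (Ioo a b ×ˢ (univ : Set ℝ)) := isOpen_Ioo.prod isOpen_univ
  have hUS : Ioo a b ×ˢ (univ : Set ℝ) ⊆ strip a b := prod_mono Ioo_subset_Ioc_self subset_rfl
  have hC0 : 0 ≤ (p * (p - 1) + p * (K * c * c)) * 2 ^ (p / 2) := by
    have : 0 ≤ p - 1 := by linarith
    positivity
  have hmeas : ∀ {ζ : ∀ z, TangentSpace 𝓘(ℝ, E) (u z)},
      (∀ z ∈ Ioo a b ×ˢ (univ : Set ℝ), SmoothFieldAt u ζ z) →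
      AEMeasurable (fun z ↦ ENNReal.ofReal (‖ζ z‖ ^ p))
        (volume.restrict (Ioc a b ×ˢ Ioc (0 : ℝ) 1)) := fun hζ ↦ by
    rw [volume_restrict_cylinder]
    exact (aemeasurable_of_continuousOn_cylinder
      ((continuousOn_norm_field hζ).rpow_const fun _ _ ↦ Or.inr hp0.le)).ennreal_ofReal
  have hfield : ∀ ζ : ∀ z, TangentSpace 𝓘(ℝ, E) (u z), fieldLpNorm a b p u ζ ^ p =
      ∫⁻ z in Ioc a b ×ˢ Ioc (0 : ℝ) 1, ENNReal.ofReal (‖ζ z‖ ^ p) := fun ζ ↦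
    lpNorm_rpow hp0 fun _ ↦ norm_nonneg _
  have hξs := hξ.smoothFieldAt
  have hη := hmeas (ζ := covDerivT a b u ξ) (smoothFieldAt_covDeriv hU hUS hξs (0, 1))
  have hζ := hmeas (ζ := covDerivS a b u ξ) (smoothFieldAt_covDeriv hU hUS hξs (1, 0))
  have hY := hmeas (ζ := covDerivT a b u X)
    (smoothFieldAt_covDeriv hU hUS hX.smoothFieldAt (0, 1))
  have hadd : AEMeasurable (fun z ↦ ENNReal.ofReal (‖ξ z‖ ^ p)
      + ENNReal.ofReal (‖covDerivS a b u ξ z‖ ^ p))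
      (volume.restrict (Ioc a b ×ˢ Ioc (0 : ℝ) 1)) := (hmeas hξs).add hζ
  have hadd' : AEMeasurable (fun z ↦ ENNReal.ofReal (‖ξ z‖ ^ p)
      + ENNReal.ofReal (‖covDerivS a b u ξ z‖ ^ p) + ENNReal.ofReal (‖covDerivT a b u ξ z‖ ^ p))
      (volume.restrict (Ioc a b ×ˢ Ioc (0 : ℝ) 1)) := hadd.add hη
  have hmain := lintegral_covDeriv_mul_rpow_le hp hK hc hab hu hs ht hξ hX
  rw [← lpNorm_rpow hp0 fun z ↦ mul_nonneg (norm_nonneg _) (norm_nonneg _),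
    lintegral_add_left' hadd', lintegral_add_left' hadd, lintegral_add_left' (hmeas hξs),
    lintegral_add_left' hY] at hmain
  simp only [← hfield] at hmain
  have hpar : fieldLpNorm a b p u ξ ^ p + fieldLpNorm a b p u (covDerivS a b u ξ) ^ p
      + fieldLpNorm a b p u (covDerivT a b u ξ) ^ p
      + fieldLpNorm a b p u (covDerivT a b u (covDerivT a b u ξ)) ^ p =
        parabolicNorm a b p u ξ ^ p := by
    rw [parabolicNorm, ← ENNReal.rpow_mul, one_div_mul_cancel hp0.ne', ENNReal.rpow_one]
  rw [hpar] at hmain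
  rw [← ENNReal.rpow_le_rpow_iff hp0, ENNReal.mul_rpow_of_nonneg _ _ hp0.le,
    ENNReal.mul_rpow_of_nonneg _ _ hp0.le, ENNReal.ofReal_rpow_of_nonneg (by positivity) hp0.le,
    ← Real.rpow_mul (by positivity), one_div_mul_cancel hp0.ne', Real.rpow_one,
    ENNReal.ofReal_mul hC0]
  refine hmain.trans ?_
  calc _ ≤ ENNReal.ofReal ((p * (p - 1) + p * (K * c * c)) * 2 ^ (p / 2)) *
        parabolicNorm a b p u ξ ^ p * (ENNReal.ofReal (1 + p) *
          (fieldLpNorm a b p u (covDerivT a b u X)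
            + fieldLpNorm a b p u (covDerivT a b u (covDerivT a b u X))) ^ p) := by
        gcongr
        -- Superadditivity of the `p`-th power for `p ≥ 1` yields the sum of the two norms at no
        -- cost in the constant.
        exact ENNReal.add_rpow_le_rpow_add _ _ (by linarith)
    _ = _ := by ring

end ProductEstimate

end

end RiemannianCylinder

theorem mainTheorem5 (p : ℝ) (hp : 2 ≤ p) (c₀ : ℝ) (hc₀ : 0 < c₀) (K : ℝ≥0) :
    ∃ C : ℝ≥0, 0 < C ∧
      ∀ (E : Type*) [NormedAddCommGroup E] [NormedSpace ℝ E] [FiniteDimensional ℝ E]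
        (N : Type*) [TopologicalSpace N] [ChartedSpace E N] [IsManifold 𝓘(ℝ, E) ∞ N]
        [RiemannianBundle (fun q : N ↦ TangentSpace 𝓘(ℝ, E) q)]
        [IsContMDiffRiemannianBundle 𝓘(ℝ, E) ∞ E (fun q : N ↦ TangentSpace 𝓘(ℝ, E) q)],
        RiemannianCylinder.curvatureSupNorm E N ≤ K →
        ∀ (a b : ℝ), a < b → ∀ u : ℝ × ℝ → N,
          RiemannianCylinder.IsSmoothMap E a b u →
          RiemannianCylinder.supNorm a b u
              (RiemannianCylinder.mapDeriv (E := E) (RiemannianCylinder.strip a b) u (1, 0))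
            + RiemannianCylinder.supNorm a b u
              (RiemannianCylinder.mapDeriv (E := E) (RiemannianCylinder.strip a b) u (0, 1))
            ≤ ENNReal.ofReal c₀ →
          ∀ ξ X : ∀ z, TangentSpace 𝓘(ℝ, E) (u z),
            RiemannianCylinder.IsSmoothCompactField a b u ξ →
            RiemannianCylinder.IsSmoothCompactField a b u X →
            RiemannianCylinder.lpNorm a b p (fun z ↦
                ‖RiemannianCylinder.covDerivT a b u ξ z‖
                  * ‖RiemannianCylinder.covDerivT a b u X z‖)
              ≤ C * RiemannianCylinder.parabolicNorm a b p u ξ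
                * (RiemannianCylinder.fieldLpNorm a b p u (RiemannianCylinder.covDerivT a b u X)
                  + RiemannianCylinder.fieldLpNorm a b p u
                      (RiemannianCylinder.covDerivT a b u
                        (RiemannianCylinder.covDerivT a b u X))) := by
  have hp0 : 0 < p := by linarith
  -- The factors come from the flux bound with `κ = K c₀²`, the regularization, and the Sobolev
  -- inequality on the circle; none involves the manifold, the map or the length of the cylinder.
  have hC : 0 < ((p * (p - 1) + p * (K * c₀ * c₀)) * 2 ^ (p / 2) * (1 + p)) ^ (1 / p) := by
    have h1 : 0 < p - 1 := by linarith
    positivity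
  refine ⟨Real.toNNReal _, Real.toNNReal_pos.2 hC, ?_⟩
  intro E _ _ _ N _ _ _ _ _ hK a b hab u hu hsup ξ X hξ hX
  exact RiemannianCylinder.lpNorm_covDeriv_mul_le hp hK hc₀.le hab hu
    (le_self_add.trans hsup) (le_add_self.trans hsup) hξ hX
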